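/- **Theorem (polynomial-time soundness for $RS_{1.1}^-$ under dynamic-programming evaluation).** *Types.* Polynomial functors are $P ::= \mathrm{Id}\mid \mathsf C_N\mid P+P\mid P\times P$, where $N ::= \mathsf{unit}\mid \mu P$ are the normal base types; $\mu P$ is the inductive data type with constructor $\mathsf c_{\mu P}:P(\mu P)\to\mu P$ and destructor $\mathsf d_{\mu P}:\mu P\to P(\mu P)$; $\mathsf{nat}=\mu(\mathsf C_{\mathsf{unit}}+\mathrm{Id})$. Ground types $\gamma$ are built by $+$ and $\times$ from the normal base types $N$ and safe copies $N^{\mathsf S}$ of them; $\gamma^{\mathsf S}$ marks all base types of $\gamma$ as safe, $\gamma^{\mathsf N}$ removes all marks; $\gamma$ is normal (safe) if all its base types are normal (safe). Function types are $\gamma_1\to\gamma_0$ with $\gamma_1,\gamma_0$ ground. *Terms of $RS_{1.1}^-$.* These are the terms of the first-order simply typed $\lambda$-calculus with unit, products and sums over these types. A term $\mathsf{case}\ e_0\ \mathsf{of}\ (\iota_1 x_1)\Rightarrow e_1;\ (\iota_2 x_2)\Rightarrow e_2$ of type $\gamma$, with $e_0:\gamma_1+\gamma_2$, is allowed only if $\gamma_1+\gamma_2$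 is normal or $\gamma$ is safe. In addition there are: $\mathsf c_{\mu P}$, $\mathsf d_{\mu P}$ and their safe versions $(P(\mu P))^{\mathsf S}\to(\mu P)^{\mathsf S}$ and $(\mu P)^{\mathsf S}\to(P(\mu P))^{\mathsf S}$; $\mathsf{fold}_{\mu P}\,(\lambda z.e_0)\,e_1:\gamma^{\mathsf S}$ for $\lambda z.e_0:P(\gamma^{\mathsf S})\to\gamma^{\mathsf S}$ and $e_1:\mu P$; $\mathsf{toSafe}\,e:\gamma^{\mathsf S}$ for $e:\gamma$; $\mathsf{toNorm}\,e:\gamma^{\mathsf N}$ for $e:\gamma$, provided that all free variables of $e$ have normal types; the safe unit $()^{\mathsf S}:\mathsf{unit}^{\mathsf S}$; and $\mathsf{cs}_{\mu P}\,e:\mathsf{nat}$ for $e:\mu P$. *Values.* A value is a finite rooted acyclic graph whose vertices are labelled by $()$, $\iota_1$, $\iota_2$, pairing, or $\mathsf c_{\mu P}$, and which is well typed (safe marks being ignored); subgraphs may be shared. $\mathrm{size}(v)$ is the number of vertices of $v$ labelled by some $\mathsf c_{\mu P}$. Two values of the same type are bisimilar if they unfold to the same tree, and the compressed size $\mathrm{cs}(v)$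 is the least size of a value bisimilar to $v$. *Evaluation and cost.* Evaluation is call-by-value. Each constructor, injection, pairing or unit creates a new root vertex; $\mathsf{toSafe}$ and $\mathsf{toNorm}$ return the value of their argument; if $e$ has value $v$, then $\mathsf{cs}_{\mu P}\,e$ evaluates to the numeral of $\mathrm{cs}(v)$. A term $\mathsf{fold}_{\mu P}\,f\,e$ is evaluated by dynamic programming: the value of the fold at each $\mathsf c_{\mu P}$-vertex of the value of $e$ is computed once, from its values at the vertices below, is stored in a table, and is looked up afterwards. The cost of an evaluation is the number of nodes of its derivation tree, look-ups and the steps of the functor action included. More generally, fix any polynomial $\chi$ with natural-number coefficients and let each node of the compressed-size rule, applied to a value $v$, count $1+\chi(\mathrm{size}(v))$ instead of $1$; the case $\chi=0$ is the number of nodes. *Claim.* Let $f:\gamma_1\to\gamma_0$ be a closed term of $RS_{1.1}^-$ with $\gamma_1$ normal. Then $f$ has polynomial cost under dynamic-programming evaluation: for every such $\chi$ there is a polynomial $q$ (depending only on $f$, its type and $\chi$) such that, for every value $v$ of type $\gamma_1$, the term $f\,x_1$ in the environment $x_1\mapsto v$ has an evaluation, and its cost is at most $q(\mathrm{size}(v))$.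 -/

import Mathlib

namespace RS11

/-! ## Types -/

/-- Polynomial functors `P ::= Id | C_N | P + P | P × P` over the normal base types
`N ::= unit | μP`.  The constant functor `C_N` is split into its two cases:
`cunit` is `C_unit` and `cmu P` is `C_{μP}`. -/
inductive PF : Type
  | id : PF
  | cunit : PF
  | cmu (P : PF) : PF
  | sum (P Q : PF) : PF
  | prod (P Q : PF) : PF

/-- Normal base types `N ::= unit | μP`. -/
inductive BTy : Type
  | unit : BTy
  | mu (P : PF) : BTy

/-- Ground types: normal base types, safe base types, sums and products. -/
inductive GTy : Type
  | norm (N : BTy) : GTy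
  | safe (N : BTy) : GTy
  | sum (γ₁ γ₂ : GTy) : GTy
  | prod (γ₁ γ₂ : GTy) : GTy

/-- All types: ground types and first-order function types `γ₁ → γ₀`. -/
inductive Ty : Type
  | ground (γ : GTy) : Ty
  | arrow (γ₁ γ₀ : GTy) : Ty

namespace GTy

/-- The (normal) unit type. -/
abbrev unit : GTy := .norm .unit

/-- The (normal) data type `μP`. -/
abbrev mu (P : PF) : GTy := .norm (.mu P)

/-- The safe version of a ground type. -/
def toSafe : GTy → GTy
  | .norm N => .safe N
  | .safe N => .safe N
  | .sum γ₁ γ₂ => .sum γ₁.toSafe γ₂.toSafe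
  | .prod γ₁ γ₂ => .prod γ₁.toSafe γ₂.toSafe

/-- The version of a ground type with all safe marks removed. -/
def toNorm : GTy → GTy
  | .norm N => .norm N
  | .safe N => .norm N
  | .sum γ₁ γ₂ => .sum γ₁.toNorm γ₂.toNorm
  | .prod γ₁ γ₂ => .prod γ₁.toNorm γ₂.toNorm

/-- Every constituent base type is normal. -/
def IsNormal : GTy → Prop
  | .norm _ => True
  | .safe _ => False
  | .sum γ₁ γ₂ => γ₁.IsNormal ∧ γ₂.IsNormal
  | .prod γ₁ γ₂ => γ₁.IsNormal ∧ γ₂.IsNormal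

/-- Every constituent base type is safe. -/
def IsSafe : GTy → Prop
  | .norm _ => False
  | .safe _ => True
  | .sum γ₁ γ₂ => γ₁.IsSafe ∧ γ₂.IsSafe
  | .prod γ₁ γ₂ => γ₁.IsSafe ∧ γ₂.IsSafe

end GTy

/-- The ground type `P(γ)`. -/
def PF.app : PF → GTy → GTy
  | .id, γ => γ
  | .cunit, _ => GTy.unit
  | .cmu P, _ => GTy.mu P
  | .sum P Q, γ => .sum (P.app γ) (Q.app γ)
  | .prod P Q, γ => .prod (P.app γ) (Q.app γ)

/-- `nat = μ(C_unit + Id)`. -/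
def natPF : PF := .sum .cunit .id

/-! ## Raw terms and typing

Variables are de Bruijn indices: `lam e`, and the two branches of `case`, bind index `0`. -/

/-- Raw terms. -/
inductive Expr : Type
  | var (i : ℕ) : Expr
  | lam (e : Expr) : Expr
  | app (e₀ e₁ : Expr) : Expr
  | unit : Expr
  | safeUnit : Expr
  | pair (e₁ e₂ : Expr) : Expr
  | fst (e : Expr) : Expr
  | snd (e : Expr) : Expr
  | inl (e : Expr) : Expr
  | inr (e : Expr) : Expr
  | case (e₀ e₁ e₂ : Expr) : Expr
  /-- The constructor of `μP`. -/
  | con (P : PF) (e : Expr) : Expr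
  /-- The destructor of `μP`. -/
  | des (P : PF) (e : Expr) : Expr
  | fold (P : PF) (f e : Expr) : Expr
  /-- The constructor of the safe version of `μP`. -/
  | safeCon (P : PF) (e : Expr) : Expr
  /-- The destructor of the safe version of `μP`. -/
  | safeDes (P : PF) (e : Expr) : Expr
  | toSafe (e : Expr) : Expr
  | toNorm (e : Expr) : Expr
  /-- The compressed-size operator of `μP`. -/
  | cs (P : PF) (e : Expr) : Expr

/-- `e.FreeIn i`: the variable with index `i` occurs free in `e`. -/
def Expr.FreeIn : Expr → ℕ → Prop
  | .var j, i => i = j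
  | .lam e, i => e.FreeIn (i + 1)
  | .app e₀ e₁, i => e₀.FreeIn i ∨ e₁.FreeIn i
  | .unit, _ => False
  | .safeUnit, _ => False
  | .pair e₁ e₂, i => e₁.FreeIn i ∨ e₂.FreeIn i
  | .fst e, i => e.FreeIn i
  | .snd e, i => e.FreeIn i
  | .inl e, i => e.FreeIn i
  | .inr e, i => e.FreeIn i
  | .case e₀ e₁ e₂, i => e₀.FreeIn i ∨ e₁.FreeIn (i + 1) ∨ e₂.FreeIn (i + 1)
  | .con _ e, i => e.FreeIn i
  | .des _ e, i => e.FreeIn i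
  | .fold _ f e, i => f.FreeIn i ∨ e.FreeIn i
  | .safeCon _ e, i => e.FreeIn i
  | .safeDes _ e, i => e.FreeIn i
  | .toSafe e, i => e.FreeIn i
  | .toNorm e, i => e.FreeIn i
  | .cs _ e, i => e.FreeIn i

/-- The typing judgment `Γ ⊢ e : τ`. -/
inductive HasTy : List GTy → Expr → Ty → Prop
  | var {Γ : List GTy} {i : ℕ} {γ : GTy} :
      Γ[i]? = some γ → HasTy Γ (.var i) (.ground γ)
  | lam {Γ : List GTy} {e : Expr} {γ₁ γ₀ : GTy} :
      HasTy (γ₁ :: Γ) e (.ground γ₀) → HasTy Γ (.lam e) (.arrow γ₁ γ₀)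
  | app {Γ : List GTy} {e₀ e₁ : Expr} {γ₁ γ₀ : GTy} :
      HasTy Γ e₀ (.arrow γ₁ γ₀) → HasTy Γ e₁ (.ground γ₁) →
      HasTy Γ (.app e₀ e₁) (.ground γ₀)
  | unit {Γ : List GTy} : HasTy Γ .unit (.ground (.norm .unit))
  | safeUnit {Γ : List GTy} : HasTy Γ .safeUnit (.ground (.safe .unit))
  | pair {Γ : List GTy} {e₁ e₂ : Expr} {γ₁ γ₂ : GTy} :
      HasTy Γ e₁ (.ground γ₁) → HasTy Γ e₂ (.ground γ₂) →
      HasTy Γ (.pair e₁ e₂) (.ground (.prod γ₁ γ₂))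
  | fst {Γ : List GTy} {e : Expr} {γ₁ γ₂ : GTy} :
      HasTy Γ e (.ground (.prod γ₁ γ₂)) → HasTy Γ (.fst e) (.ground γ₁)
  | snd {Γ : List GTy} {e : Expr} {γ₁ γ₂ : GTy} :
      HasTy Γ e (.ground (.prod γ₁ γ₂)) → HasTy Γ (.snd e) (.ground γ₂)
  | inl {Γ : List GTy} {e : Expr} {γ₁ γ₂ : GTy} :
      HasTy Γ e (.ground γ₁) → HasTy Γ (.inl e) (.ground (.sum γ₁ γ₂))
  | inr {Γ : List GTy} {e : Expr} {γ₁ γ₂ : GTy} :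
      HasTy Γ e (.ground γ₂) → HasTy Γ (.inr e) (.ground (.sum γ₁ γ₂))
  | case {Γ : List GTy} {e₀ e₁ e₂ : Expr} {γ₁ γ₂ γ : GTy} :
      HasTy Γ e₀ (.ground (.sum γ₁ γ₂)) →
      HasTy (γ₁ :: Γ) e₁ (.ground γ) → HasTy (γ₂ :: Γ) e₂ (.ground γ) →
      ((GTy.sum γ₁ γ₂).IsNormal ∨ γ.IsSafe) →
      HasTy Γ (.case e₀ e₁ e₂) (.ground γ)
  | con {Γ : List GTy} {P : PF} {e : Expr} :
      HasTy Γ e (.ground (P.app (GTy.mu P))) → HasTy Γ (.con P e) (.ground (GTy.mu P))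
  | des {Γ : List GTy} {P : PF} {e : Expr} :
      HasTy Γ e (.ground (GTy.mu P)) → HasTy Γ (.des P e) (.ground (P.app (GTy.mu P)))
  | fold {Γ : List GTy} {P : PF} {e₀ e₁ : Expr} {γ : GTy} :
      HasTy Γ (.lam e₀) (.arrow (P.app γ.toSafe) γ.toSafe) →
      HasTy Γ e₁ (.ground (GTy.mu P)) →
      HasTy Γ (.fold P (.lam e₀) e₁) (.ground γ.toSafe)
  | safeCon {Γ : List GTy} {P : PF} {e : Expr} :
      HasTy Γ e (.ground (P.app (GTy.mu P)).toSafe) →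
      HasTy Γ (.safeCon P e) (.ground (GTy.mu P).toSafe)
  | safeDes {Γ : List GTy} {P : PF} {e : Expr} :
      HasTy Γ e (.ground (GTy.mu P).toSafe) →
      HasTy Γ (.safeDes P e) (.ground (P.app (GTy.mu P)).toSafe)
  | toSafe {Γ : List GTy} {e : Expr} {γ : GTy} :
      HasTy Γ e (.ground γ) → HasTy Γ (.toSafe e) (.ground γ.toSafe)
  | toNorm {Γ : List GTy} {e : Expr} {γ : GTy} :
      HasTy Γ e (.ground γ) →
      (∀ i, e.FreeIn i → ∃ γ', Γ[i]? = some γ' ∧ γ'.IsNormal) →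
      HasTy Γ (.toNorm e) (.ground γ.toNorm)
  | cs {Γ : List GTy} {P : PF} {e : Expr} :
      HasTy Γ e (.ground (GTy.mu P)) → HasTy Γ (.cs P e) (.ground (GTy.mu natPF))

/-! ## Value term graphs

A value term graph is given by a heap (a finite list of labeled vertices, addressed by their
positions) together with the address of its root; its vertices are those reachable from the root.
Distinct graphs in one heap may share vertices. -/

/-- A vertex: its label and the targets of its out-edges. -/
inductive Node : Type
  | unit : Node
  | inl (a : ℕ) : Node
  | inr (a : ℕ) : Node
  | pair (a b : ℕ) : Node
  | con (P : PF) (a : ℕ) : Node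

/-- The addresses to which a vertex points. -/
def Node.children : Node → List ℕ
  | .unit => []
  | .inl a => [a]
  | .inr a => [a]
  | .pair a b => [a, b]
  | .con _ a => [a]

abbrev Heap : Type := List Node

/-- There is an edge from `a` to `b`. -/
def Edge (H : Heap) (a b : ℕ) : Prop := ∃ n, H[a]? = some n ∧ b ∈ n.children

/-- `b` is a vertex of the graph rooted at `a`. -/
def Reach (H : Heap) (a b : ℕ) : Prop := Relation.ReflTransGen (Edge H) a b

/-- The size of the graph rooted at `a`: the number of its data-type-constructor vertices. -/
noncomputable def size (H : Heap) (a : ℕ) : ℕ :=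
  Set.ncard {b : ℕ | Reach H a b ∧ ∃ P c, H[b]? = some (Node.con P c)}

/-- `ValTy H γ a`, for `γ` without safe constituents: the graph rooted at `a` is a type-`γ` value.
The relation is inductive, so the graph rooted at `a` is acyclic. -/
inductive ValTy (H : Heap) : GTy → ℕ → Prop
  | unit {a : ℕ} : H[a]? = some .unit → ValTy H (.norm .unit) a
  | pair {γ₁ γ₂ : GTy} {a b₁ b₂ : ℕ} : H[a]? = some (.pair b₁ b₂) →
      ValTy H γ₁ b₁ → ValTy H γ₂ b₂ → ValTy H (.prod γ₁ γ₂) a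
  | inl {γ₁ γ₂ : GTy} {a b : ℕ} : H[a]? = some (.inl b) →
      ValTy H γ₁ b → ValTy H (.sum γ₁ γ₂) a
  | inr {γ₁ γ₂ : GTy} {a b : ℕ} : H[a]? = some (.inr b) →
      ValTy H γ₂ b → ValTy H (.sum γ₁ γ₂) a
  | con {P : PF} {a b : ℕ} : H[a]? = some (.con P b) →
      ValTy H (P.app (GTy.mu P)) b → ValTy H (.norm (.mu P)) a

/-- The graph rooted at `a` is a type-`γ` value, for an arbitrary ground type `γ`: safe marks are
irrelevant for values. -/
def IsValue (H : Heap) (γ : GTy) (a : ℕ) : Prop := ValTy H γ.toNorm a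

/-- Bisimilarity, at a type without safe constituents, of the graph rooted at `a` in `H` and the
graph rooted at `a'` in `H'`. -/
inductive Bisim (H H' : Heap) : GTy → ℕ → ℕ → Prop
  | unit {a a' : ℕ} : H[a]? = some .unit → H'[a']? = some .unit →
      Bisim H H' (.norm .unit) a a'
  | pair {γ₁ γ₂ : GTy} {a b₁ b₂ a' b₁' b₂' : ℕ} :
      H[a]? = some (.pair b₁ b₂) → H'[a']? = some (.pair b₁' b₂') →
      Bisim H H' γ₁ b₁ b₁' → Bisim H H' γ₂ b₂ b₂' → Bisim H H' (.prod γ₁ γ₂) a a'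
  | inl {γ₁ γ₂ : GTy} {a b a' b' : ℕ} :
      H[a]? = some (.inl b) → H'[a']? = some (.inl b') →
      Bisim H H' γ₁ b b' → Bisim H H' (.sum γ₁ γ₂) a a'
  | inr {γ₁ γ₂ : GTy} {a b a' b' : ℕ} :
      H[a]? = some (.inr b) → H'[a']? = some (.inr b') →
      Bisim H H' γ₂ b b' → Bisim H H' (.sum γ₁ γ₂) a a'
  | con {P : PF} {a b a' b' : ℕ} :
      H[a]? = some (.con P b) → H'[a']? = some (.con P b') →
      Bisim H H' (P.app (GTy.mu P)) b b' → Bisim H H' (.norm (.mu P)) a a'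

/-- The compressed size of the type-`γ` value rooted at `a`: the least size of a value that is
bisimilar to it. -/
noncomputable def compSize (H : Heap) (γ : GTy) (a : ℕ) : ℕ :=
  sInf {s : ℕ | ∃ (H' : Heap) (a' : ℕ), Bisim H H' γ a a' ∧ size H' a' = s}

/-- Adds fresh vertices that form the `nat`-value of `m`, whose root is the last one. -/
def numeral (H : Heap) : ℕ → Heap
  | 0 => H ++ [.unit, .inl H.length, .con natPF (H.length + 1)]
  | m + 1 => numeral H m ++
      [.inr ((numeral H m).length - 1), .con natPF (numeral H m).length]

/-! ## Dynamic-programming evaluation -/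

/-- The results of one fold that are already available: vertices of the argument of the fold
with the roots of the values computed for them. -/
abbrev Memo : Type := ℕ → Option ℕ

/- In all three judgments below the last argument is the number of nodes of the derivation, except
that a node of the compressed-size rule at a value of size `s` counts `1 + χ s`. -/
mutual

/-- `Eval χ θ H e H' a c`: in the environment `θ` (the roots, in the heap `H`, of the values of the
variables), the term `e` evaluates to the value rooted at `a` in `H'`; the heap `H'` extends `H` by
the vertices created on the way. -/
inductive Eval (χ : ℕ → ℕ) : List ℕ → Heap → Expr → Heap → ℕ → ℕ → Prop
  | var {θ : List ℕ} {H : Heap} {i a : ℕ} :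
      θ[i]? = some a → Eval χ θ H (.var i) H a 1
  | app {θ : List ℕ} {H H₁ H₂ : Heap} {e₀ e₁ : Expr} {a₁ a c₁ c₀ : ℕ} :
      Eval χ θ H e₁ H₁ a₁ c₁ → Eval χ (a₁ :: θ) H₁ e₀ H₂ a c₀ →
      Eval χ θ H (.app (.lam e₀) e₁) H₂ a (1 + c₁ + c₀)
  | unit {θ : List ℕ} {H : Heap} : Eval χ θ H .unit (H ++ [.unit]) H.length 1
  | safeUnit {θ : List ℕ} {H : Heap} : Eval χ θ H .safeUnit (H ++ [.unit]) H.length 1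
  | pair {θ : List ℕ} {H H₁ H₂ : Heap} {e₁ e₂ : Expr} {a₁ a₂ c₁ c₂ : ℕ} :
      Eval χ θ H e₁ H₁ a₁ c₁ → Eval χ θ H₁ e₂ H₂ a₂ c₂ →
      Eval χ θ H (.pair e₁ e₂) (H₂ ++ [.pair a₁ a₂]) H₂.length (1 + c₁ + c₂)
  | fst {θ : List ℕ} {H H₁ : Heap} {e : Expr} {a a₁ a₂ c : ℕ} :
      Eval χ θ H e H₁ a c → H₁[a]? = some (.pair a₁ a₂) →
      Eval χ θ H (.fst e) H₁ a₁ (1 + c)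
  | snd {θ : List ℕ} {H H₁ : Heap} {e : Expr} {a a₁ a₂ c : ℕ} :
      Eval χ θ H e H₁ a c → H₁[a]? = some (.pair a₁ a₂) →
      Eval χ θ H (.snd e) H₁ a₂ (1 + c)
  | inl {θ : List ℕ} {H H₁ : Heap} {e : Expr} {a c : ℕ} :
      Eval χ θ H e H₁ a c → Eval χ θ H (.inl e) (H₁ ++ [.inl a]) H₁.length (1 + c)
  | inr {θ : List ℕ} {H H₁ : Heap} {e : Expr} {a c : ℕ} :
      Eval χ θ H e H₁ a c → Eval χ θ H (.inr e) (H₁ ++ [.inr a]) H₁.length (1 + c)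
  | caseInl {θ : List ℕ} {H H₁ H₂ : Heap} {e₀ e₁ e₂ : Expr} {a b v c₀ c₁ : ℕ} :
      Eval χ θ H e₀ H₁ a c₀ → H₁[a]? = some (.inl b) → Eval χ (b :: θ) H₁ e₁ H₂ v c₁ →
      Eval χ θ H (.case e₀ e₁ e₂) H₂ v (1 + c₀ + c₁)
  | caseInr {θ : List ℕ} {H H₁ H₂ : Heap} {e₀ e₁ e₂ : Expr} {a b v c₀ c₂ : ℕ} :
      Eval χ θ H e₀ H₁ a c₀ → H₁[a]? = some (.inr b) → Eval χ (b :: θ) H₁ e₂ H₂ v c₂ →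
      Eval χ θ H (.case e₀ e₁ e₂) H₂ v (1 + c₀ + c₂)
  | con {θ : List ℕ} {H H₁ : Heap} {P : PF} {e : Expr} {a c : ℕ} :
      Eval χ θ H e H₁ a c → Eval χ θ H (.con P e) (H₁ ++ [.con P a]) H₁.length (1 + c)
  | des {θ : List ℕ} {H H₁ : Heap} {P : PF} {e : Expr} {a b c : ℕ} :
      Eval χ θ H e H₁ a c → H₁[a]? = some (.con P b) → Eval χ θ H (.des P e) H₁ b (1 + c)
  | fold {θ : List ℕ} {H H₁ H₂ : Heap} {P : PF} {e₀ e₁ : Expr} {M : Memo} {a v c₁ c₂ : ℕ} :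
      Eval χ θ H e₁ H₁ a c₁ →
      FoldAt χ P e₀ θ H₁ (fun _ => none) a H₂ M v c₂ →
      Eval χ θ H (.fold P (.lam e₀) e₁) H₂ v (1 + c₁ + c₂)
  | safeCon {θ : List ℕ} {H H₁ : Heap} {P : PF} {e : Expr} {a c : ℕ} :
      Eval χ θ H e H₁ a c →
      Eval χ θ H (.safeCon P e) (H₁ ++ [.con P a]) H₁.length (1 + c)
  | safeDes {θ : List ℕ} {H H₁ : Heap} {P : PF} {e : Expr} {a b c : ℕ} :
      Eval χ θ H e H₁ a c → H₁[a]? = some (.con P b) →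
      Eval χ θ H (.safeDes P e) H₁ b (1 + c)
  | toSafe {θ : List ℕ} {H H₁ : Heap} {e : Expr} {a c : ℕ} :
      Eval χ θ H e H₁ a c → Eval χ θ H (.toSafe e) H₁ a (1 + c)
  | toNorm {θ : List ℕ} {H H₁ : Heap} {e : Expr} {a c : ℕ} :
      Eval χ θ H e H₁ a c → Eval χ θ H (.toNorm e) H₁ a (1 + c)
  | cs {θ : List ℕ} {H H₁ : Heap} {P : PF} {e : Expr} {a c : ℕ} :
      Eval χ θ H e H₁ a c →
      Eval χ θ H (.cs P e) (numeral H₁ (compSize H₁ (GTy.mu P) a))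
        ((numeral H₁ (compSize H₁ (GTy.mu P) a)).length - 1) (1 + χ (size H₁ a) + c)

/-- `FoldAt χ P e₀ θ H M a H' M' v c`: the fold over `μP` with step function `λz. e₀` (in the
environment `θ`) has at the vertex `a` the value rooted at `v`.  If the value is in the table `M`
it is looked up; otherwise it is computed from the values at the vertices below `a` and entered
into the table. -/
inductive FoldAt (χ : ℕ → ℕ) :
    PF → Expr → List ℕ → Heap → Memo → ℕ → Heap → Memo → ℕ → ℕ → Prop
  | hit {P : PF} {e₀ : Expr} {θ : List ℕ} {H : Heap} {M : Memo} {a v : ℕ} :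
      M a = some v → FoldAt χ P e₀ θ H M a H M v 1
  | miss {P : PF} {e₀ : Expr} {θ : List ℕ} {H H₁ H₂ : Heap} {M M₁ : Memo}
      {a b b' v c₁ c₂ : ℕ} :
      M a = none → H[a]? = some (.con P b) →
      MapAt χ P e₀ θ P H M b H₁ M₁ b' c₁ → Eval χ (b' :: θ) H₁ e₀ H₂ v c₂ →
      FoldAt χ P e₀ θ H M a H₂ (Function.update M₁ a (some v)) v (1 + c₁ + c₂)

/-- `MapAt χ P e₀ θ Q H M b H' M' b' c`: the action of the functor `Q` on the fold over `μP` with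
step function `λz. e₀`, applied to the value rooted at `b`, gives the value rooted at `b'`. -/
inductive MapAt (χ : ℕ → ℕ) :
    PF → Expr → List ℕ → PF → Heap → Memo → ℕ → Heap → Memo → ℕ → ℕ → Prop
  | id {P : PF} {e₀ : Expr} {θ : List ℕ} {H H₁ : Heap} {M M₁ : Memo} {b v c : ℕ} :
      FoldAt χ P e₀ θ H M b H₁ M₁ v c → MapAt χ P e₀ θ .id H M b H₁ M₁ v (1 + c)
  | cunit {P : PF} {e₀ : Expr} {θ : List ℕ} {H : Heap} {M : Memo} {b : ℕ} :
      MapAt χ P e₀ θ .cunit H M b H M b 1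
  | cmu {P R : PF} {e₀ : Expr} {θ : List ℕ} {H : Heap} {M : Memo} {b : ℕ} :
      MapAt χ P e₀ θ (.cmu R) H M b H M b 1
  | prod {P Q₁ Q₂ : PF} {e₀ : Expr} {θ : List ℕ} {H H₁ H₂ : Heap} {M M₁ M₂ : Memo}
      {b b₁ b₂ v₁ v₂ c₁ c₂ : ℕ} :
      H[b]? = some (.pair b₁ b₂) →
      MapAt χ P e₀ θ Q₁ H M b₁ H₁ M₁ v₁ c₁ → MapAt χ P e₀ θ Q₂ H₁ M₁ b₂ H₂ M₂ v₂ c₂ →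
      MapAt χ P e₀ θ (.prod Q₁ Q₂) H M b (H₂ ++ [.pair v₁ v₂]) M₂ H₂.length (1 + c₁ + c₂)
  | inl {P Q₁ Q₂ : PF} {e₀ : Expr} {θ : List ℕ} {H H₁ : Heap} {M M₁ : Memo}
      {b b₁ v₁ c : ℕ} :
      H[b]? = some (.inl b₁) → MapAt χ P e₀ θ Q₁ H M b₁ H₁ M₁ v₁ c →
      MapAt χ P e₀ θ (.sum Q₁ Q₂) H M b (H₁ ++ [.inl v₁]) M₁ H₁.length (1 + c)
  | inr {P Q₁ Q₂ : PF} {e₀ : Expr} {θ : List ℕ} {H H₁ : Heap} {M M₁ : Memo}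
      {b b₂ v₂ c : ℕ} :
      H[b]? = some (.inr b₂) → MapAt χ P e₀ θ Q₂ H M b₂ H₁ M₁ v₂ c →
      MapAt χ P e₀ θ (.sum Q₁ Q₂) H M b (H₁ ++ [.inr v₂]) M₁ H₁.length (1 + c)

end

/-- The closed term `f : γ₁ → γ₀` is a polynomial-cost function under dynamic-programming
evaluation: there is a polynomial `q` such that, for each value of the variable `x₁ : γ₁`
(rooted at `r` in a heap `H`), the term `f x₁` has an evaluation, and its cost is at most `q` of
the size of the value.  As `f` is closed, `f x₁` is `Expr.app f (Expr.var 0)`. -/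
def DPPolyCost (χ : ℕ → ℕ) (f : Expr) (γ₁ : GTy) : Prop :=
  ∃ q : Polynomial ℕ, ∀ (H : Heap) (r : ℕ), IsValue H γ₁ r →
    (∃ H' a c, Eval χ [r] H (.app f (.var 0)) H' a c) ∧
    ∀ H' a c, Eval χ [r] H (.app f (.var 0)) H' a c → c ≤ q.eval (size H r)

end RS11

namespace RS11

-- The invariant `Good` bounds only the subgraphs at normal base types; safe parts may be
-- arbitrarily large. By induction on typing, each term has a polynomial `B` (the predicate `Sound`)
-- such that, in any environment whose normal parts have size at most `n`, an evaluation exists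
-- whose cost, number of new vertices and sizes of normal parts of the result are at most `B.eval
-- n`. Heaps only grow, so earlier values keep their vertices and sizes.
--
-- The critical case is `fold`. The step function consumes previous results at the safe type
-- `γ.toSafe`, which `Good` does not bound, so each call obeys the same bound however large those
-- results have become; the normal data it sees are subgraphs of the folded value or come from the
-- environment. Thanks to the table it is called at most once per constructor vertex of the
-- argument. `fold_exists` proves this by an amortized count, with the number of table entries as
-- potential, and `Sound.fold` multiplies the two bounds.
--
-- The other delicate case is `toNorm`, which turns an unbounded safe value into a bounded normal
-- one. For this, `Outcome` also records that a result consists of new vertices and of vertices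
-- reachable from the values of free variables. The new vertices are few, and under `toNorm` the
-- free variables are normal, hence small (`Sound.toNorm`). Counting vertices rather than unfolded
-- trees is what makes this work in the presence of sharing.
--
-- Finally, evaluation is deterministic (`Eval.det`), so the bound on the constructed evaluation
-- holds for all of them.

theorem eval_le_eval (p : Polynomial ℕ) {m n : ℕ} (h : m ≤ n) : p.eval m ≤ p.eval n := by
  simp only [Polynomial.eval_eq_sum_range]
  gcongr

-- Safe and normal marks on types

namespace GTy

theorem toNorm_toSafe (γ : GTy) : γ.toSafe.toNorm = γ.toNorm := by
  induction γ <;> simp_all [toSafe, toNorm]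

theorem IsNormal.toNorm_eq {γ : GTy} (h : γ.IsNormal) : γ.toNorm = γ := by
  induction γ <;> simp_all [IsNormal, toNorm]

theorem isNormal_toNorm (γ : GTy) : γ.toNorm.IsNormal := by
  induction γ <;> simp_all [IsNormal, toNorm]

/-- The number of base types occurring in a ground type. -/
def leaves : GTy → ℕ
  | .norm _ => 1
  | .safe _ => 1
  | .sum γ₁ γ₂ => γ₁.leaves + γ₂.leaves
  | .prod γ₁ γ₂ => γ₁.leaves + γ₂.leaves

end GTy

theorem PF.isNormal_app (Q : PF) {γ : GTy} (h : γ.IsNormal) : (Q.app γ).IsNormal := by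
  induction Q <;> simp_all [PF.app, GTy.IsNormal]

theorem PF.isNormal_app_mu (Q P : PF) : (Q.app (GTy.mu P)).IsNormal :=
  Q.isNormal_app trivial

/-! ### Heaps and reachability -/

theorem getElem?_of_prefix {H H' : Heap} (h : H <+: H') {a : ℕ} {n : Node} (ha : H[a]? = some n) :
    H'[a]? = some n := by
  obtain ⟨t, rfl⟩ := h
  rw [List.getElem?_append_left (List.getElem?_eq_some_iff.1 ha).1, ha]

theorem Reach.lift {H H' : Heap} (h : H <+: H') {a b : ℕ} (hr : Reach H a b) : Reach H' a b := by
  induction hr with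
  | refl => exact .refl
  | tail _ he ih =>
    obtain ⟨n, hn, hc⟩ := he
    exact ih.tail ⟨n, getElem?_of_prefix h hn, hc⟩

theorem Reach.child {H : Heap} {a b : ℕ} {n : Node} (ha : H[a]? = some n)
    (hb : b ∈ n.children) : Reach H a b :=
  Relation.ReflTransGen.single ⟨n, ha, hb⟩

theorem Reach.eq_or_child {H : Heap} {a c : ℕ} {n : Node} (ha : H[a]? = some n)
    (h : Reach H a c) : c = a ∨ ∃ b ∈ n.children, Reach H b c := by
  rcases Relation.ReflTransGen.cases_head h with h | ⟨b, ⟨m, hm, hb⟩, hbc⟩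
  · exact .inl h.symm
  · rw [ha] at hm
    cases hm
    exact .inr ⟨b, hb, hbc⟩

namespace ValTy

variable {H H' : Heap} {γ : GTy} {a b : ℕ}

theorem mono (h : H <+: H') (ha : ValTy H γ a) : ValTy H' γ a := by
  induction ha with
  | unit h₁ => exact .unit (getElem?_of_prefix h h₁)
  | pair h₁ _ _ i₁ i₂ => exact .pair (getElem?_of_prefix h h₁) i₁ i₂
  | inl h₁ _ i₁ => exact .inl (getElem?_of_prefix h h₁) i₁
  | inr h₁ _ i₁ => exact .inr (getElem?_of_prefix h h₁) i₁
  | con h₁ _ i₁ => exact .con (getElem?_of_prefix h h₁) i₁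

theorem lt_length (ha : ValTy H γ a) : a < H.length := by
  cases ha <;> exact (List.getElem?_eq_some_iff.1 (by assumption)).1

theorem edge (ha : ValTy H γ a) (he : Edge H a b) : ∃ γ', ValTy H γ' b := by
  obtain ⟨n, hn, hb⟩ := he
  cases ha with
  | unit h₁ =>
    rw [h₁] at hn; cases hn
    simp [Node.children] at hb
  | pair h₁ t₁ t₂ =>
    rw [h₁] at hn; cases hn
    simp only [Node.children, List.mem_cons, List.not_mem_nil, or_false] at hb
    rcases hb with rfl | rfl
    exacts [⟨_, t₁⟩, ⟨_, t₂⟩]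
  | inl h₁ t | inr h₁ t | con h₁ t =>
    rw [h₁] at hn; cases hn
    simp only [Node.children, List.mem_cons, List.not_mem_nil, or_false] at hb
    subst hb
    exact ⟨_, t⟩

theorem reach (ha : ValTy H γ a) (hr : Reach H a b) : ∃ γ', ValTy H γ' b := by
  induction hr with
  | refl => exact ⟨_, ha⟩
  | tail _ he ih => exact ih.choose_spec.edge he

/-- New vertices are appended and old ones never change, so the out-edges of a complete value are
the same in every later heap. -/
theorem reach_of_prefix (h : H <+: H') (ha : ValTy H γ a) (hr : Reach H' a b) : Reach H a b := by
  induction hr with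
  | refl => exact .refl
  | @tail c d _ he ih =>
    obtain ⟨n, hn, hb⟩ := he
    obtain ⟨γ', hc⟩ := ha.reach ih
    have h₂ := List.getElem?_eq_getElem hc.lt_length
    rw [getElem?_of_prefix h h₂] at hn
    cases hn
    exact ih.tail ⟨_, h₂, hb⟩

theorem acc (ha : ValTy H γ a) : Acc (flip (Edge H)) a := by
  induction ha with
  | unit h₁ =>
    refine ⟨_, fun b ⟨n, hn, hb⟩ => ?_⟩
    rw [h₁] at hn; cases hn
    simp [Node.children] at hb
  | pair h₁ _ _ i₁ i₂ =>
    refine ⟨_, fun b ⟨n, hn, hb⟩ => ?_⟩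
    rw [h₁] at hn; cases hn
    simp only [Node.children, List.mem_cons, List.not_mem_nil, or_false] at hb
    rcases hb with rfl | rfl
    exacts [i₁, i₂]
  | inl h₁ _ i | inr h₁ _ i | con h₁ _ i =>
    refine ⟨_, fun b ⟨n, hn, hb⟩ => ?_⟩
    rw [h₁] at hn; cases hn
    simp only [Node.children, List.mem_cons, List.not_mem_nil, or_false] at hb
    subst hb
    exact i

/-- A cycle through `a` would also be a cycle through its child `b`, and so on forever downwards,
against accessibility. The fold uses this: computing below a vertex cannot fill that vertex's own
table entry. -/
theorem not_reach_of_edge (ha : ValTy H γ a) (he : Edge H a b) : ¬ Reach H b a := by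
  intro hr
  have hacc := ha.acc
  have key : ∀ x, Acc (flip (Edge H)) x → ∀ y, Edge H x y → ¬ Reach H y x := by
    intro x hx
    induction hx with
    | intro x _ ih =>
      intro y hxy hyx
      rcases Relation.ReflTransGen.cases_head hyx with rfl | ⟨z, hyz, hzx⟩
      · exact ih _ hxy _ hxy .refl
      · exact ih y hxy z hyz (hzx.tail hxy)
  exact key a hacc b he hr

theorem bisim_refl (ha : ValTy H γ a) : Bisim H H γ a a := by
  induction ha with
  | unit h₁ => exact .unit h₁ h₁
  | pair h₁ _ _ i₁ i₂ => exact .pair h₁ h₁ i₁ i₂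
  | inl h₁ _ i => exact .inl h₁ h₁ i
  | inr h₁ _ i => exact .inr h₁ h₁ i
  | con h₁ _ i => exact .con h₁ h₁ i

theorem compSize_le (ha : ValTy H γ a) : compSize H γ a ≤ size H a :=
  Nat.sInf_le ⟨H, a, ha.bisim_refl, rfl⟩

end ValTy

/-! ### Size -/

/-- The data-type-constructor vertices of the graph rooted at `a`. -/
def conSet (H : Heap) (a : ℕ) : Set ℕ :=
  {b : ℕ | Reach H a b ∧ ∃ P c, H[b]? = some (Node.con P c)}

theorem size_eq (H : Heap) (a : ℕ) : size H a = (conSet H a).ncard := rfl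

theorem lt_of_mem_conSet {H : Heap} {a b : ℕ} (h : b ∈ conSet H a) : b < H.length := by
  obtain ⟨_, P, c, h⟩ := h
  exact (List.getElem?_eq_some_iff.1 h).1

theorem finite_conSet (H : Heap) (a : ℕ) : (conSet H a).Finite :=
  (Set.finite_Iio H.length).subset fun _ h => lt_of_mem_conSet h

theorem size_le_of_reach {H : Heap} {a b : ℕ} (h : Reach H a b) : size H b ≤ size H a :=
  Set.ncard_le_ncard (fun _ ⟨h₁, h₂⟩ => ⟨h.trans h₁, h₂⟩) (finite_conSet H a)

theorem ValTy.conSet_eq {H H' : Heap} {γ : GTy} {a : ℕ} (h : H <+: H') (ha : ValTy H γ a) :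
    conSet H' a = conSet H a := by
  ext b
  constructor
  · rintro ⟨hr, P, c, hb⟩
    have hr := ha.reach_of_prefix h hr
    obtain ⟨γ', hb'⟩ := ha.reach hr
    have h₂ := List.getElem?_eq_getElem hb'.lt_length
    rw [getElem?_of_prefix h h₂] at hb
    exact ⟨hr, P, c, h₂.trans hb⟩
  · rintro ⟨hr, P, c, hb⟩
    exact ⟨hr.lift h, P, c, getElem?_of_prefix h hb⟩

theorem ValTy.size_eq {H H' : Heap} {γ : GTy} {a : ℕ} (h : H <+: H') (ha : ValTy H γ a) :
    size H' a = size H a := by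
  rw [RS11.size_eq, RS11.size_eq, ha.conSet_eq h]

theorem size_pair_le {H : Heap} {a b₁ b₂ : ℕ} (h : H[a]? = some (.pair b₁ b₂)) :
    size H a ≤ size H b₁ + size H b₂ := by
  refine (Set.ncard_le_ncard ?_ ((finite_conSet H b₁).union (finite_conSet H b₂))).trans
    (Set.ncard_union_le (conSet H b₁) (conSet H b₂))
  rintro x ⟨hr, P, c, hx⟩
  rcases hr.eq_or_child h with rfl | ⟨b, hb, hbx⟩
  · rw [h] at hx; cases hx
  · simp only [Node.children, List.mem_cons, List.not_mem_nil, or_false] at hb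
    rcases hb with rfl | rfl
    exacts [.inl ⟨hbx, P, c, hx⟩, .inr ⟨hbx, P, c, hx⟩]

theorem size_le_of_single {H : Heap} {a b : ℕ} {n : Node} (h : H[a]? = some n)
    (hn : n.children = [b]) (hc : ∀ P c, n ≠ .con P c) : size H a ≤ size H b := by
  refine Set.ncard_le_ncard ?_ (finite_conSet H b)
  rintro x ⟨hr, P, c, hx⟩
  rcases hr.eq_or_child h with rfl | ⟨b', hb, hbx⟩
  · rw [h] at hx; cases hx
    exact absurd rfl (hc P c)
  · simp only [hn, List.mem_cons, List.not_mem_nil, or_false] at hb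
    subst hb
    exact ⟨hbx, P, c, hx⟩

theorem size_con_le {H : Heap} {a b : ℕ} {P : PF} (h : H[a]? = some (.con P b)) :
    size H a ≤ size H b + 1 := by
  refine (Set.ncard_le_ncard ?_ ((finite_conSet H b).insert a)).trans (Set.ncard_insert_le _ _)
  rintro x ⟨hr, P, c, hx⟩
  rcases hr.eq_or_child h with rfl | ⟨b', hb, hbx⟩
  · exact .inl rfl
  · simp only [Node.children, List.mem_cons, List.not_mem_nil, or_false] at hb
    subst hb
    exact .inr ⟨hbx, P, c, hx⟩

theorem size_unit {H : Heap} {a : ℕ} (h : H[a]? = some .unit) : size H a = 0 := by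
  have : conSet H a = ∅ := by
    ext x
    simp only [Set.mem_empty_iff_false, iff_false]
    rintro ⟨hr, P, c, hx⟩
    rcases hr.eq_or_child h with rfl | ⟨b', hb, hbx⟩
    · rw [h] at hx; cases hx
    · simp [Node.children] at hb
  rw [size_eq, this, Set.ncard_empty]

/-! ### Values with bounded normal parts -/

/-- The graph rooted at `a` is a type-`γ` value, and its subgraphs at the normal base types
of `γ` have size at most `n`. -/
def Good (H : Heap) (n : ℕ) : GTy → ℕ → Prop
  | .norm N, a => ValTy H (.norm N) a ∧ size H a ≤ n
  | .safe N, a => ValTy H (.norm N) a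
  | .sum γ₁ γ₂, a => (∃ b, H[a]? = some (.inl b) ∧ Good H n γ₁ b) ∨
      ∃ b, H[a]? = some (.inr b) ∧ Good H n γ₂ b
  | .prod γ₁ γ₂, a => ∃ b₁ b₂, H[a]? = some (.pair b₁ b₂) ∧ Good H n γ₁ b₁ ∧ Good H n γ₂ b₂

namespace Good

variable {H H' : Heap} {n m : ℕ} {γ : GTy} {a : ℕ}

theorem isValue (h : Good H n γ a) : IsValue H γ a := by
  induction γ generalizing a with
  | norm N => exact h.1
  | safe N => exact h
  | sum γ₁ γ₂ i₁ i₂ =>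
    rcases h with ⟨b, hb, h⟩ | ⟨b, hb, h⟩
    exacts [.inl hb (i₁ h), .inr hb (i₂ h)]
  | prod γ₁ γ₂ i₁ i₂ =>
    obtain ⟨b₁, b₂, hb, h₁, h₂⟩ := h
    exact .pair hb (i₁ h₁) (i₂ h₂)

theorem mono (hH : H <+: H') (hn : n ≤ m) (h : Good H n γ a) : Good H' m γ a := by
  induction γ generalizing a with
  | norm N => exact ⟨h.1.mono hH, (h.1.size_eq hH).trans_le (h.2.trans hn)⟩
  | safe N => exact ValTy.mono hH h
  | sum γ₁ γ₂ i₁ i₂ =>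
    rcases h with ⟨b, hb, h⟩ | ⟨b, hb, h⟩
    exacts [.inl ⟨b, getElem?_of_prefix hH hb, i₁ h⟩, .inr ⟨b, getElem?_of_prefix hH hb, i₂ h⟩]
  | prod γ₁ γ₂ i₁ i₂ =>
    obtain ⟨b₁, b₂, hb, h₁, h₂⟩ := h
    exact ⟨b₁, b₂, getElem?_of_prefix hH hb, i₁ h₁, i₂ h₂⟩

/-- At a safe type the size bound is vacuous, so it may be replaced by any `m`. This is why bounds
do not accumulate along a fold. -/
theorem toSafe (h : Good H n γ a) (m : ℕ) : Good H m γ.toSafe a := by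
  induction γ generalizing a with
  | norm N => exact h.1
  | safe N => exact h
  | sum γ₁ γ₂ i₁ i₂ =>
    rcases h with ⟨b, hb, h⟩ | ⟨b, hb, h⟩
    exacts [.inl ⟨b, hb, i₁ h⟩, .inr ⟨b, hb, i₂ h⟩]
  | prod γ₁ γ₂ i₁ i₂ =>
    obtain ⟨b₁, b₂, hb, h₁, h₂⟩ := h
    exact ⟨b₁, b₂, hb, i₁ h₁, i₂ h₂⟩

theorem of_valTy (hγ : γ.IsNormal) (ha : ValTy H γ a) (hn : size H a ≤ n) : Good H n γ a := by
  induction ha with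
  | unit h₁ => exact ⟨.unit h₁, hn⟩
  | pair h₁ _ _ i₁ i₂ =>
    exact ⟨_, _, h₁,
      i₁ hγ.1 ((size_le_of_reach (.child h₁ (by simp [Node.children]))).trans hn),
      i₂ hγ.2 ((size_le_of_reach (.child h₁ (by simp [Node.children]))).trans hn)⟩
  | inl h₁ _ i =>
    exact .inl ⟨_, h₁, i hγ.1 ((size_le_of_reach (.child h₁ (by simp [Node.children]))).trans hn)⟩
  | inr h₁ _ i =>
    exact .inr ⟨_, h₁, i hγ.2 ((size_le_of_reach (.child h₁ (by simp [Node.children]))).trans hn)⟩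
  | con h₁ h₂ _ => exact ⟨.con h₁ h₂, hn⟩

/-- Above the base-type parts there are only pairing and injection vertices, which do not count
towards the size; shared vertices only make the sum over the leaves an overestimate. -/
theorem size_le (hγ : γ.IsNormal) (h : Good H n γ a) : size H a ≤ γ.leaves * n := by
  induction γ generalizing a with
  | norm N => simpa [GTy.leaves] using h.2
  | safe N => exact hγ.elim
  | sum γ₁ γ₂ i₁ i₂ =>
    simp only [GTy.leaves, add_mul]
    rcases h with ⟨b, hb, h⟩ | ⟨b, hb, h⟩
    · exact (size_le_of_single hb rfl (by simp)).trans ((i₁ hγ.1 h).trans (Nat.le_add_right _ _))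
    · exact (size_le_of_single hb rfl (by simp)).trans ((i₂ hγ.2 h).trans (Nat.le_add_left _ _))
  | prod γ₁ γ₂ i₁ i₂ =>
    obtain ⟨b₁, b₂, hb, h₁, h₂⟩ := h
    simp only [GTy.leaves, add_mul]
    exact (size_pair_le hb).trans (add_le_add (i₁ hγ.1 h₁) (i₂ hγ.2 h₂))

end Good

-- Values confined to a set of vertices

/-- Every vertex of the graph rooted at `a` lies in `S`. -/
def Within (H : Heap) (S : Set ℕ) (a : ℕ) : Prop := ∀ b, Reach H a b → b ∈ S

theorem Within.mono {H H' : Heap} {S : Set ℕ} {n : ℕ} {γ : GTy} {a : ℕ} (hH : H <+: H')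
    (ha : Good H n γ a) (h : Within H S a) : Within H' S a :=
  fun b hb => h b (ha.isValue.reach_of_prefix hH hb)

theorem Within.of_reach {H : Heap} {S : Set ℕ} {a b : ℕ} (h : Within H S a) (hr : Reach H a b) :
    Within H S b :=
  fun c hc => h c (hr.trans hc)

theorem within_of_children {H : Heap} {S : Set ℕ} {a : ℕ} {n : Node} (ha : H[a]? = some n)
    (haS : a ∈ S) (h : ∀ b ∈ n.children, Within H S b) : Within H S a := by
  intro c hc
  rcases hc.eq_or_child ha with rfl | ⟨b, hb, hbc⟩
  exacts [haS, h b hb c hbc]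

theorem size_le_of_within {H : Heap} {L a : ℕ} (h : Within H (Set.Ici L) a) :
    size H a ≤ H.length - L := by
  have : conSet H a ⊆ (Finset.Ico L H.length : Set ℕ) := fun b hb => by
    simpa using ⟨h b hb.1, lt_of_mem_conSet hb⟩
  exact (Set.ncard_le_ncard this (Finset.finite_toSet _)).trans_eq
    (by rw [Set.ncard_coe_finset, Nat.card_Ico])

/-! ### Numerals -/

theorem prefix_numeral (H : Heap) (m : ℕ) : H <+: numeral H m := by
  induction m with
  | zero => exact List.prefix_append _ _
  | succ m ih => exact ih.trans (List.prefix_append _ _)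

theorem length_numeral (H : Heap) (m : ℕ) : (numeral H m).length = H.length + 2 * m + 3 := by
  induction m with
  | zero => simp [numeral]
  | succ m ih => simp [numeral, ih]; ring

theorem getElem?_snoc (H : Heap) (x : Node) : (H ++ [x])[H.length]? = some x := by simp

/-- Since the numeral consists of fresh vertices only, its size is bounded by the growth of the heap
and needs no count of its own. -/
theorem numeral_spec (H : Heap) (m : ℕ) :
    ValTy (numeral H m) (GTy.mu natPF) ((numeral H m).length - 1) ∧
      Within (numeral H m) (Set.Ici H.length) ((numeral H m).length - 1) := by
  induction m with
  | zero =>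
    have h0 : (numeral H 0)[H.length]? = some .unit := by simp [numeral]
    have h1 : (numeral H 0)[H.length + 1]? = some (.inl H.length) := by simp [numeral]
    have h2 : (numeral H 0)[H.length + 2]? = some (.con natPF (H.length + 1)) := by simp [numeral]
    have hl : (numeral H 0).length - 1 = H.length + 2 := by simp [numeral]
    rw [hl]
    refine ⟨.con h2 (.inl h1 (.unit h0)), ?_⟩
    refine within_of_children h2 (by simp) fun b hb => ?_
    simp only [Node.children, List.mem_singleton] at hb
    subst hb
    refine within_of_children h1 (by simp) fun b hb => ?_
    simp only [Node.children, List.mem_singleton] at hb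
    subst hb
    exact within_of_children h0 (by simp) fun b hb => by simp [Node.children] at hb
  | succ m ih =>
    have hp : numeral H m <+: numeral H (m + 1) := List.prefix_append _ _
    have h1 : (numeral H (m + 1))[(numeral H m).length]? =
        some (.inr ((numeral H m).length - 1)) := by simp [numeral]
    have h2 : (numeral H (m + 1))[(numeral H m).length + 1]? =
        some (.con natPF (numeral H m).length) := by simp [numeral]
    have hl : (numeral H (m + 1)).length - 1 = (numeral H m).length + 1 := by simp [numeral]
    have hle := (prefix_numeral H m).length_le
    rw [hl]
    refine ⟨.con h2 (.inr h1 (ih.1.mono hp)), ?_⟩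
    refine within_of_children h2 (by simp; omega) fun b hb => ?_
    simp only [Node.children, List.mem_singleton] at hb
    subst hb
    refine within_of_children h1 (by simpa using hle) fun b hb => ?_
    simp only [Node.children, List.mem_singleton] at hb
    subst hb
    exact fun c hc => ih.2 c (ih.1.reach_of_prefix hp hc)

/-! ### Environments -/

/-- The environment `θ` assigns to each variable of `Γ` a value of its type, whose normal parts
have size at most `n`. -/
def GoodEnv (H : Heap) (n : ℕ) (Γ : List GTy) (θ : List ℕ) : Prop :=
  ∀ (i : ℕ) (γ : GTy), Γ[i]? = some γ → ∃ a, θ[i]? = some a ∧ Good H n γ a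

theorem GoodEnv.mono {H H' : Heap} {n m : ℕ} {Γ : List GTy} {θ : List ℕ} (hH : H <+: H')
    (hn : n ≤ m) (h : GoodEnv H n Γ θ) : GoodEnv H' m Γ θ := fun i γ hi =>
  let ⟨a, ha, hg⟩ := h i γ hi
  ⟨a, ha, hg.mono hH hn⟩

theorem GoodEnv.cons {H : Heap} {n : ℕ} {Γ : List GTy} {θ : List ℕ} {γ : GTy} {a : ℕ}
    (ha : Good H n γ a) (h : GoodEnv H n Γ θ) : GoodEnv H n (γ :: Γ) (a :: θ) := by
  rintro (_ | i) γ' hi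
  · simp only [List.getElem?_cons_zero, Option.some.injEq] at hi
    subst hi
    exact ⟨a, rfl, ha⟩
  · simpa using h i γ' (by simpa using hi)

/-- The values of the variables of `Γ` satisfying `F` lie within `S`. -/
def EnvWithin (H : Heap) (S : Set ℕ) (Γ : List GTy) (F : ℕ → Prop) (θ : List ℕ) : Prop :=
  ∀ (i : ℕ) (γ : GTy) (a : ℕ), Γ[i]? = some γ → F i → θ[i]? = some a → Within H S a

theorem EnvWithin.cons {H : Heap} {S : Set ℕ} {Γ : List GTy} {F : ℕ → Prop} {θ : List ℕ}
    {γ : GTy} {a : ℕ} (ha : Within H S a) (h : EnvWithin H S Γ (fun i => F (i + 1)) θ) :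
    EnvWithin H S (γ :: Γ) F (a :: θ) := by
  rintro (_ | i) γ' b hΓ hF hi
  · simp only [List.getElem?_cons_zero, Option.some.injEq] at hi
    exact hi ▸ ha
  · exact h i γ' b (by simpa using hΓ) hF (by simpa using hi)

theorem EnvWithin.imp {H : Heap} {S : Set ℕ} {Γ : List GTy} {F G : ℕ → Prop} {θ : List ℕ}
    (h : EnvWithin H S Γ F θ) (hGF : ∀ i, G i → F i) : EnvWithin H S Γ G θ :=
  fun i γ a hΓ hG hi => h i γ a hΓ (hGF i hG) hi

theorem EnvWithin.mono {H H' : Heap} {S : Set ℕ} {Γ : List GTy} {F : ℕ → Prop} {θ : List ℕ}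
    {n : ℕ} (hH : H <+: H') (hθ : GoodEnv H n Γ θ) (h : EnvWithin H S Γ F θ) :
    EnvWithin H' S Γ F θ := by
  intro i γ a hΓ hF hi
  obtain ⟨a', ha', hg⟩ := hθ i γ hΓ
  obtain rfl : a = a' := Option.some.inj (hi.symm.trans ha')
  exact (h i γ a hΓ hF hi).mono hH hg


-- Outcomes of evaluation

theorem GTy.toSafe_toSafe (γ : GTy) : γ.toSafe.toSafe = γ.toSafe := by
  induction γ <;> simp_all [GTy.toSafe]

/-- The result of evaluating `e : γ` in the heap `H`: the cost, the number of new vertices and the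
sizes of the normal parts of the value are at most `B`, and the value consists of new vertices and
of vertices of the values of the free variables of `e`. -/
structure Outcome (B : ℕ) (Γ : List GTy) (e : Expr) (γ : GTy) (θ : List ℕ) (H H' : Heap)
    (a c : ℕ) : Prop where
  pre : H <+: H'
  cost : c ≤ B
  len : H'.length ≤ H.length + B
  good : Good H' B γ a
  -- Quantifying over `S` makes the clause compose: a value bound by a binder that lies in `S` is
  -- one more instance of the `EnvWithin` hypothesis.
  within : ∀ S : Set ℕ, (∀ b, H.length ≤ b → b ∈ S) → EnvWithin H S Γ e.FreeIn θ → Within H' S a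

-- Dynamic-programming folds

/-- A bound on the cost and the number of new vertices of the functor action of `Q`, apart from
the computation of new values of the fold. -/
def PF.weight : PF → ℕ
  -- One node for the functor action, one for a look-up of the fold.
  | .id => 2
  | .cunit => 1
  | .cmu _ => 1
  | .sum P Q => 1 + P.weight + Q.weight
  | .prod P Q => 1 + P.weight + Q.weight

/-- The number of constructor vertices of the graph rooted at `r` that have an entry in `M`. -/
noncomputable def entries (H : Heap) (r : ℕ) (M : Memo) : ℕ :=
  ((finite_conSet H r).toFinset.filter fun x => (M x).isSome).card

theorem entries_le (H : Heap) (r : ℕ) (M : Memo) : entries H r M ≤ size H r := by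
  rw [size_eq, Set.ncard_eq_toFinset_card _ (finite_conSet H r)]
  exact Finset.card_filter_le _ _

theorem entries_update {H : Heap} {r a v : ℕ} {M : Memo} (ha : a ∈ conSet H r)
    (hM : M a = none) : entries H r (Function.update M a (some v)) = entries H r M + 1 := by
  have : (finite_conSet H r).toFinset.filter
        (fun x => (Function.update M a (some v) x).isSome) =
      insert a ((finite_conSet H r).toFinset.filter fun x => (M x).isSome) := by
    ext x
    by_cases hx : x = a
    · subst hx; simp [ha]
    · simp [hx]
  rw [entries, this, Finset.card_insert_of_notMem (by simp [hM]), entries]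

/-- The heap extends `H`, and the entries of the table are values of type `σ` that lie within
each of the sets of `𝒮`. -/
structure FoldInv (𝒮 : Set (Set ℕ)) (n : ℕ) (σ : GTy) (H Hc : Heap) (M : Memo) : Prop where
  pre : H <+: Hc
  good : ∀ x v, M x = some v → Good Hc n σ v
  within : ∀ x v, M x = some v → ∀ S ∈ 𝒮, Within Hc S v

theorem FoldInv.mono {𝒮 : Set (Set ℕ)} {n : ℕ} {σ : GTy} {H Hc Hc' : Heap} {M : Memo}
    (h : FoldInv 𝒮 n σ H Hc M) (hH : Hc <+: Hc') : FoldInv 𝒮 n σ H Hc' M where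
  pre := h.pre.trans hH
  good x v hx := (h.good x v hx).mono hH le_rfl
  within x v hx S hS := (h.within x v hx S hS).mono hH (h.good x v hx)

theorem FoldInv.update {𝒮 : Set (Set ℕ)} {n a v : ℕ} {σ : GTy} {H Hc : Heap} {M : Memo}
    (h : FoldInv 𝒮 n σ H Hc M) (hv : Good Hc n σ v) (hS : ∀ S ∈ 𝒮, Within Hc S v) :
    FoldInv 𝒮 n σ H Hc (Function.update M a (some v)) where
  pre := h.pre
  good x w hx := by
    by_cases hxa : x = a
    · subst hxa
      simp only [Function.update_self, Option.some.injEq] at hx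
      exact hx ▸ hv
    · exact h.good x w (by rwa [Function.update_of_ne hxa] at hx)
  within x w hx := by
    by_cases hxa : x = a
    · subst hxa
      simp only [Function.update_self, Option.some.injEq] at hx
      exact hx ▸ hS
    · exact h.within x w (by rwa [Function.update_of_ne hxa] at hx)

/-- The result `v : δ` of a part of a fold below the vertex `b` of its argument, which is rooted at
`r` in `H`: the cost and the number of new vertices are at most `w`, plus `K` for each new entry of
the table. -/
structure FoldStep (𝒮 : Set (Set ℕ)) (n K : ℕ) (σ : GTy) (H : Heap) (r w : ℕ) (δ : GTy) (b : ℕ)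
    (Hc : Heap) (M : Memo) (H' : Heap) (M' : Memo) (v c : ℕ) : Prop where
  pre : Hc <+: H'
  inv : FoldInv 𝒮 n σ H H' M'
  good : Good H' n δ v
  within : ∀ S ∈ 𝒮, Within H' S v
  cost : c + K * entries H r M ≤ K * entries H r M' + w
  len : H'.length + K * entries H r M ≤ Hc.length + K * entries H r M' + w
  dom : ∀ x, M' x ≠ none → M x ≠ none ∨ Reach H b x

/-- Amortized analysis with potential `K * entries`, where `K = P.weight + 1 + β`: a look-up costs
1, and a miss costs at most `P.weight` for the functor action, 1 for its own node and `β` for the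
step function, which its new table entry pays for. The induction on the argument treats the fold and
the functor actions together. `Q` stays universally quantified because the type of a vertex does not
determine it: a vertex of type `μP` may be a recursive position (`id`) or a constant (`cmu P`). -/
theorem fold_exists {χ : ℕ → ℕ} {P : PF} {e₀ : Expr} {Γ : List GTy} {θ : List ℕ} {γ : GTy}
    {n β r : ℕ} {H : Heap} {𝒮 : Set (Set ℕ)}
    (hstep : ∀ Hc θ', GoodEnv Hc n (P.app γ.toSafe :: Γ) θ' → ∃ H' v c, Eval χ θ' Hc e₀ H' v c ∧
      Outcome β (P.app γ.toSafe :: Γ) e₀ γ.toSafe θ' Hc H' v c)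
    (hθ : GoodEnv H n Γ θ) (hr : size H r ≤ n)
    (hnew : ∀ S ∈ 𝒮, ∀ b, H.length ≤ b → b ∈ S)
    (henv : ∀ S ∈ 𝒮, EnvWithin H S Γ (fun i => e₀.FreeIn (i + 1)) θ)
    (hroot : ∀ S ∈ 𝒮, Within H S r) {δ : GTy} {b : ℕ} (hb : ValTy H δ b) (hrb : Reach H r b) :
    (δ = GTy.mu P → ∀ Hc M, FoldInv 𝒮 n γ.toSafe H Hc M → ∃ H' M' v c,
      FoldAt χ P e₀ θ Hc M b H' M' v c ∧
      FoldStep 𝒮 n (P.weight + 1 + β) γ.toSafe H r 1 γ.toSafe b Hc M H' M' v c) ∧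
    (∀ Q : PF, δ = Q.app (GTy.mu P) → ∀ Hc M, FoldInv 𝒮 n γ.toSafe H Hc M → ∃ H' M' v c,
      MapAt χ P e₀ θ Q Hc M b H' M' v c ∧
      FoldStep 𝒮 n (P.weight + 1 + β) γ.toSafe H r Q.weight (Q.app γ.toSafe) b
        Hc M H' M' v c) := by
  induction hb with
  | @unit b h₁ =>
    refine ⟨fun h => by simp at h, fun Q hQ Hc M hI => ?_⟩
    cases Q <;> simp [PF.app] at hQ
    refine ⟨Hc, M, b, 1, .cunit, List.prefix_rfl, hI, ?_, fun S hS => ?_, ?_, ?_, fun x hx => .inl hx⟩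
    · exact (show Good H n GTy.unit b from ⟨.unit h₁, (size_le_of_reach hrb).trans hr⟩).mono
        hI.pre le_rfl
    · exact ((hroot S hS).of_reach hrb).mono (n := n) (γ := GTy.unit) hI.pre
        ⟨.unit h₁, (size_le_of_reach hrb).trans hr⟩
    · simp [PF.weight]; omega
    · simp
  | @pair γ₁ γ₂ b b₁ b₂ h₁ t₁ t₂ i₁ i₂ =>
    refine ⟨fun h => by simp at h, fun Q hQ Hc M hI => ?_⟩
    cases Q <;> simp [PF.app] at hQ
    rename_i Q₁ Q₂
    obtain ⟨rfl, rfl⟩ := hQ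
    have e₁ : Reach H b b₁ := .child h₁ (by simp [Node.children])
    have e₂ : Reach H b b₂ := .child h₁ (by simp [Node.children])
    obtain ⟨H₁, M₁, v₁, c₁, hm₁, s₁⟩ := (i₁ (hrb.trans e₁)).2 Q₁ rfl Hc M hI
    obtain ⟨H₂, M₂, v₂, c₂, hm₂, s₂⟩ := (i₂ (hrb.trans e₂)).2 Q₂ rfl H₁ M₁ s₁.inv
    have hp : H₂ <+: H₂ ++ [Node.pair v₁ v₂] := List.prefix_append _ _
    have hg := getElem?_snoc H₂ (Node.pair v₁ v₂)
    refine ⟨_, M₂, _, _, .prod (getElem?_of_prefix hI.pre h₁) hm₁ hm₂,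
      s₁.pre.trans (s₂.pre.trans hp), s₂.inv.mono hp, ?_, fun S hS => ?_, ?_, ?_, fun x hx => ?_⟩
    · exact ⟨v₁, v₂, hg, s₁.good.mono (s₂.pre.trans hp) le_rfl, s₂.good.mono hp le_rfl⟩
    · refine within_of_children hg (hnew S hS _ s₂.inv.pre.length_le) fun x hx => ?_
      simp only [Node.children, List.mem_cons, List.not_mem_nil, or_false] at hx
      rcases hx with rfl | rfl
      exacts [(s₁.within S hS).mono (s₂.pre.trans hp) s₁.good, (s₂.within S hS).mono hp s₂.good]
    · have := s₁.cost; have := s₂.cost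
      simp only [PF.weight]; omega
    · have := s₁.len; have := s₂.len
      simp only [PF.weight, List.length_append, List.length_singleton]; omega
    · rcases s₂.dom x hx with hx | hx
      · exact (s₁.dom x hx).imp_right e₁.trans
      · exact .inr (e₂.trans hx)
  | @inl γ₁ γ₂ b b₁ h₁ t₁ i₁ =>
    refine ⟨fun h => by simp at h, fun Q hQ Hc M hI => ?_⟩
    cases Q <;> simp [PF.app] at hQ
    rename_i Q₁ Q₂
    obtain ⟨rfl, rfl⟩ := hQ
    have e₁ : Reach H b b₁ := .child h₁ (by simp [Node.children])
    obtain ⟨H₁, M₁, v₁, c₁, hm₁, s₁⟩ := (i₁ (hrb.trans e₁)).2 Q₁ rfl Hc M hI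
    have hp : H₁ <+: H₁ ++ [Node.inl v₁] := List.prefix_append _ _
    have hg := getElem?_snoc H₁ (Node.inl v₁)
    refine ⟨_, M₁, _, _, .inl (getElem?_of_prefix hI.pre h₁) hm₁,
      s₁.pre.trans hp, s₁.inv.mono hp, .inl ⟨v₁, hg, s₁.good.mono hp le_rfl⟩,
      fun S hS => ?_, ?_, ?_, fun x hx => (s₁.dom x hx).imp_right e₁.trans⟩
    · refine within_of_children hg (hnew S hS _ s₁.inv.pre.length_le) fun x hx => ?_
      simp only [Node.children, List.mem_singleton] at hx
      subst hx
      exact (s₁.within S hS).mono hp s₁.good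
    · have := s₁.cost
      simp only [PF.weight]; omega
    · have := s₁.len
      simp only [PF.weight, List.length_append, List.length_singleton]; omega
  | @inr γ₁ γ₂ b b₁ h₁ t₁ i₁ =>
    refine ⟨fun h => by simp at h, fun Q hQ Hc M hI => ?_⟩
    cases Q <;> simp [PF.app] at hQ
    rename_i Q₁ Q₂
    obtain ⟨rfl, rfl⟩ := hQ
    have e₁ : Reach H b b₁ := .child h₁ (by simp [Node.children])
    obtain ⟨H₁, M₁, v₁, c₁, hm₁, s₁⟩ := (i₁ (hrb.trans e₁)).2 Q₂ rfl Hc M hI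
    have hp : H₁ <+: H₁ ++ [Node.inr v₁] := List.prefix_append _ _
    have hg := getElem?_snoc H₁ (Node.inr v₁)
    refine ⟨_, M₁, _, _, .inr (getElem?_of_prefix hI.pre h₁) hm₁,
      s₁.pre.trans hp, s₁.inv.mono hp, .inr ⟨v₁, hg, s₁.good.mono hp le_rfl⟩,
      fun S hS => ?_, ?_, ?_, fun x hx => (s₁.dom x hx).imp_right e₁.trans⟩
    · refine within_of_children hg (hnew S hS _ s₁.inv.pre.length_le) fun x hx => ?_
      simp only [Node.children, List.mem_singleton] at hx
      subst hx
      exact (s₁.within S hS).mono hp s₁.good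
    · have := s₁.cost
      simp only [PF.weight]; omega
    · have := s₁.len
      simp only [PF.weight, List.length_append, List.length_singleton]; omega
  | @con R b b₁ h₁ t₁ i₁ =>
    have e₁ : Edge H b b₁ := ⟨_, h₁, by simp [Node.children]⟩
    have hfold : GTy.mu R = GTy.mu P → ∀ Hc M, FoldInv 𝒮 n γ.toSafe H Hc M → ∃ H' M' v c,
        FoldAt χ P e₀ θ Hc M b H' M' v c ∧
        FoldStep 𝒮 n (P.weight + 1 + β) γ.toSafe H r 1 γ.toSafe b Hc M H' M' v c := by
      intro hR Hc M hI
      cases hR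
      cases hMb : M b with
      | some v =>
        exact ⟨Hc, M, v, 1, .hit hMb, List.prefix_rfl, hI, hI.good b v hMb, hI.within b v hMb,
          by omega, by omega, fun x hx => .inl hx⟩
      | none =>
        obtain ⟨H₁, M₁, b', c₁, hm₁, s₁⟩ := (i₁ (hrb.tail e₁)).2 P rfl Hc M hI
        obtain ⟨H₂, v, c₂, hev, o⟩ := hstep H₁ (b' :: θ)
          (.cons s₁.good (hθ.mono s₁.inv.pre le_rfl))
        -- By `dom`, the work below `b` enters only vertices reachable from its child; acyclicity
        -- excludes `b`, so the later update raises `entries` by exactly one.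
        have hM₁ : M₁ b = none := by
          by_contra hne
          rcases s₁.dom b hne with h | h
          · exact h hMb
          · exact (ValTy.con h₁ t₁).not_reach_of_edge e₁ h
        -- The step function gives only the bound `β`; safety of the result type resets it to `n`,
        -- restoring the table invariant.
        have hgood : Good H₂ n γ.toSafe v := γ.toSafe_toSafe ▸ o.good.toSafe n
        have hwith : ∀ S ∈ 𝒮, Within H₂ S v := fun S hS =>
          o.within S (fun x hx => hnew S hS x (s₁.inv.pre.length_le.trans hx))
            (.cons (s₁.within S hS) ((henv S hS).mono s₁.inv.pre hθ))
        have hent := entries_update (v := v) (show b ∈ conSet H r from ⟨hrb, P, b₁, h₁⟩) hM₁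
        refine ⟨H₂, _, v, _, .miss hMb (getElem?_of_prefix hI.pre h₁) hm₁ hev,
          s₁.pre.trans o.pre, (s₁.inv.mono o.pre).update hgood hwith, hgood, hwith, ?_, ?_,
          fun x hx => ?_⟩
        · have := s₁.cost; have := o.cost
          rw [hent, mul_add]; omega
        · have := s₁.len; have := o.len
          rw [hent, mul_add]; omega
        · by_cases hxb : x = b
          · subst hxb; exact .inr .refl
          · rw [Function.update_of_ne hxb] at hx
            exact (s₁.dom x hx).imp_right fun h => Relation.ReflTransGen.head e₁ h
    refine ⟨hfold, fun Q hQ Hc M hI => ?_⟩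
    cases Q <;> simp [PF.app] at hQ
    · obtain ⟨H', M', v, c, hf, s⟩ := hfold (by rw [hQ]) Hc M hI
      exact ⟨H', M', v, _, .id hf, s.pre, s.inv, s.good, s.within,
        by have := s.cost; simp only [PF.weight]; omega,
        by have := s.len; simp only [PF.weight]; omega, s.dom⟩
    · subst hQ
      have hg : Good H n (GTy.mu R) b := ⟨.con h₁ t₁, (size_le_of_reach hrb).trans hr⟩
      exact ⟨Hc, M, b, 1, .cmu, List.prefix_rfl, hI, hg.mono hI.pre le_rfl,
        fun S hS => ((hroot S hS).of_reach hrb).mono hI.pre hg,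
        by simp only [PF.weight]; omega, by omega, fun x hx => .inl hx⟩


-- Polynomial bounds for the term formers

/-- Every evaluation problem for `e : γ` has a solution whose cost, number of new vertices and
sizes of normal parts are polynomial in the sizes of the normal parts of the environment. -/
def Sound (χ : ℕ → ℕ) (Γ : List GTy) (e : Expr) (γ : GTy) : Prop :=
  ∃ B : Polynomial ℕ, ∀ n H θ, GoodEnv H n Γ θ → ∃ H' a c,
    Eval χ θ H e H' a c ∧ Outcome (B.eval n) Γ e γ θ H H' a c

theorem Outcome.mono {B B' : ℕ} {Γ : List GTy} {e : Expr} {γ : GTy} {θ : List ℕ} {H H' : Heap}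
    {a c : ℕ} (hB : B ≤ B') (h : Outcome B Γ e γ θ H H' a c) : Outcome B' Γ e γ θ H H' a c where
  pre := h.pre
  cost := h.cost.trans hB
  len := h.len.trans (Nat.add_le_add_left hB _)
  good := h.good.mono List.prefix_rfl hB
  within := h.within

/-- The case of a term whose value is a vertex of the value of its immediate subterm. -/
theorem Sound.of_reach {χ : ℕ → ℕ} {Γ : List GTy} {e e' : Expr} {γ γ' : GTy}
    (h : Sound χ Γ e γ) (hF : ∀ i, e.FreeIn i → e'.FreeIn i)
    (hE : ∀ n H a, Good H n γ a → ∃ b, Reach H a b ∧ Good H n γ' b ∧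
      ∀ θ H₀ c, Eval χ θ H₀ e H a c → Eval χ θ H₀ e' H b (1 + c)) :
    Sound χ Γ e' γ' := by
  obtain ⟨B, h⟩ := h
  refine ⟨B + 1, fun n H θ hθ => ?_⟩
  obtain ⟨H', a, c, hev, o⟩ := h n H θ hθ
  obtain ⟨b, hr, hg, he⟩ := hE _ _ _ o.good
  have := o.cost; have := o.len
  simp only [Polynomial.eval_add, Polynomial.eval_one]
  exact ⟨H', b, _, he _ _ _ hev, o.pre, by omega, by omega,
    hg.mono List.prefix_rfl (Nat.le_succ _), fun S hS hSθ => (o.within S hS (hSθ.imp hF)).of_reach hr⟩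

/-- The case of a term whose value is a new vertex above the value of its immediate subterm. -/
theorem Sound.of_vertex {χ : ℕ → ℕ} {Γ : List GTy} {e e' : Expr} {γ γ' : GTy} {N : ℕ → Node} {K : ℕ}
    (h : Sound χ Γ e γ) (hF : ∀ i, e.FreeIn i → e'.FreeIn i) (hN : ∀ a, (N a).children = [a])
    (hG : ∀ n H a b, Good H n γ a → H[b]? = some (N a) → Good H (K * n + 1) γ' b)
    (hE : ∀ θ H₀ H a c, Eval χ θ H₀ e H a c → Eval χ θ H₀ e' (H ++ [N a]) H.length (1 + c)) :
    Sound χ Γ e' γ' := by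
  obtain ⟨B, h⟩ := h
  refine ⟨Polynomial.C (K + 1) * B + 1, fun n H θ hθ => ?_⟩
  obtain ⟨H', a, c, hev, o⟩ := h n H θ hθ
  have hp : H' <+: H' ++ [N a] := List.prefix_append _ _
  have hg := getElem?_snoc H' (N a)
  have := o.cost; have := o.len
  simp only [Polynomial.eval_add, Polynomial.eval_one, Polynomial.eval_mul, Polynomial.eval_C,
    add_mul, one_mul]
  refine ⟨_, _, _, hE _ _ _ _ _ hev, o.pre.trans hp, by omega, ?_,
    (hG _ _ a _ (o.good.mono hp le_rfl) hg).mono List.prefix_rfl (by omega), fun S hS hSθ => ?_⟩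
  · simp only [List.length_append, List.length_singleton]; omega
  · refine within_of_children hg (hS _ o.pre.length_le) fun x hx => ?_
    simp only [hN, List.mem_singleton] at hx
    subst hx
    exact (o.within S hS (hSθ.imp hF)).mono hp o.good

/-- The case of a term whose evaluation ends with that of a subterm under one binder. -/
theorem Sound.bind {χ : ℕ → ℕ} {Γ : List GTy} {e₀ e : Expr} {γ₁ γ δ : GTy} {B B₀ : Polynomial ℕ}
    (h₀ : ∀ n H θ, GoodEnv H n (γ₁ :: Γ) θ → ∃ H' a c,
      Eval χ θ H e₀ H' a c ∧ Outcome (B₀.eval n) (γ₁ :: Γ) e₀ γ θ H H' a c)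
    {n b : ℕ} {H H₁ : Heap} {θ : List ℕ} {e₁ : Expr} {a₁ c₁ : ℕ}
    (o₁ : Outcome (B.eval n) Γ e₁ δ θ H H₁ a₁ c₁) (hθ : GoodEnv H n Γ θ)
    (hF₀ : ∀ i, e₀.FreeIn (i + 1) → e.FreeIn i) (hF₁ : ∀ i, e₁.FreeIn i → e.FreeIn i)
    (hb : Good H₁ (B.eval n) γ₁ b) (hr : Reach H₁ a₁ b)
    (hE : ∀ H' a c₀, Eval χ (b :: θ) H₁ e₀ H' a c₀ → Eval χ θ H e H' a (1 + c₁ + c₀)) :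
    ∃ H' a c, Eval χ θ H e H' a c ∧
      Outcome ((1 + B + B₀.comp (.X + B)).eval n) Γ e γ θ H H' a c := by
  obtain ⟨H', a, c₀, hev, o⟩ := h₀ (n + B.eval n) H₁ (b :: θ)
    (.cons (hb.mono List.prefix_rfl (by omega)) (hθ.mono o₁.pre (by omega)))
  have := o.cost; have := o.len; have := o₁.cost; have := o₁.len
  simp only [Polynomial.eval_add, Polynomial.eval_one, Polynomial.eval_comp, Polynomial.eval_X]
  refine ⟨H', a, _, hE _ _ _ hev, o₁.pre.trans o.pre, by omega, by omega,
    o.good.mono List.prefix_rfl (by omega), fun S hS hSθ => ?_⟩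
  exact o.within S (fun x hx => hS x (o₁.pre.length_le.trans hx))
    (.cons ((o₁.within S hS (hSθ.imp hF₁)).of_reach hr) ((hSθ.imp hF₀).mono o₁.pre hθ))

/-- The size of the result is at most the number of new vertices, bounded by `B.eval n`, plus the
sizes of the values of the free variables. These are normal, so each has size at most its number of
leaves times `n`. -/
theorem Sound.toNorm {χ : ℕ → ℕ} {Γ : List GTy} {e : Expr} {γ : GTy} (h : Sound χ Γ e γ)
    (hΓ : ∀ i, e.FreeIn i → ∃ γ', Γ[i]? = some γ' ∧ γ'.IsNormal) :
    Sound χ Γ (.toNorm e) γ.toNorm := by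
  obtain ⟨B, h⟩ := h
  set W : ℕ := ∑ i ∈ Finset.range Γ.length, (Γ[i]?.elim 0 GTy.leaves) with hW
  refine ⟨1 + B + Polynomial.C W * .X, fun n H θ hθ => ?_⟩
  obtain ⟨H', a, c, hev, o⟩ := h n H θ hθ
  have hc := o.cost; have hl := o.len
  simp only [Polynomial.eval_add, Polynomial.eval_one, Polynomial.eval_mul, Polynomial.eval_C,
    Polynomial.eval_X]
  refine ⟨H', a, _, .toNorm hev, o.pre, by omega, by omega, ?_, fun S hS hSθ => o.within S hS hSθ⟩
  refine Good.of_valTy γ.isNormal_toNorm o.good.isValue ?_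
  classical
  let T : ℕ → Set ℕ := fun i => {b | e.FreeIn i ∧ ∃ x, θ[i]? = some x ∧ b ∈ conSet H x}
  have hT : ∀ i ∈ Finset.range Γ.length, (T i).ncard ≤ Γ[i]?.elim 0 GTy.leaves * n := by
    intro i _
    by_cases hi : e.FreeIn i
    · obtain ⟨γ', hγ', hn⟩ := hΓ i hi
      obtain ⟨x, hx, hg⟩ := hθ i γ' hγ'
      have : T i = conSet H x := by
        ext b
        simp [T, hi, hx]
      rw [this, hγ']
      exact hg.size_le hn
    · have : T i = ∅ := by
        ext b
        simp [T, hi]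
      simp [this]
  -- The smallest admissible set: fresh vertices and everything reachable from the values of the
  -- free variables.
  have hw := o.within (Set.Ici H.length ∪ {b | ∃ i x, e.FreeIn i ∧ θ[i]? = some x ∧ Reach H x b})
    (fun b hb => .inl hb) fun i _ x _ hF hx b hb => .inr ⟨i, x, hF, hx, hb⟩
  have hsub : conSet H' a ⊆ (Finset.Ico H.length H'.length : Set ℕ) ∪
      ⋃ i ∈ Finset.range Γ.length, T i := by
    intro b hb
    rcases hw b hb.1 with h | ⟨i, x, hF, hx, hr⟩
    · exact .inl (by simpa using ⟨h, lt_of_mem_conSet hb⟩)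
    · refine .inr ?_
      obtain ⟨γ', hγ', hn⟩ := hΓ i hF
      obtain ⟨y, hy, hg⟩ := hθ i γ' hγ'
      obtain rfl : x = y := Option.some.inj (hx.symm.trans hy)
      have hi := (List.getElem?_eq_some_iff.1 hγ').1
      simp only [Set.mem_iUnion, Finset.mem_range]
      refine ⟨i, hi, hF, x, hx, ?_⟩
      rw [← hg.isValue.conSet_eq o.pre]
      exact ⟨hr.lift o.pre, hb.2⟩
  have hfin : (⋃ i ∈ Finset.range Γ.length, T i).Finite := by
    refine Set.Finite.biUnion (Finset.finite_toSet _) fun i _ => ?_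
    refine (Set.finite_Iio H.length).subset ?_
    rintro b ⟨_, x, _, hb⟩
    exact lt_of_mem_conSet hb
  have h1 := Set.ncard_le_ncard hsub ((Finset.finite_toSet _).union hfin)
  have h2 := Set.ncard_union_le (Finset.Ico H.length H'.length : Set ℕ)
    (⋃ i ∈ Finset.range Γ.length, T i)
  have h3 := Finset.set_ncard_biUnion_le (Finset.range Γ.length) T
  have h4 := Finset.sum_le_sum hT
  rw [← Finset.sum_mul, ← hW] at h4
  rw [Set.ncard_coe_finset, Nat.card_Ico] at h2
  rw [size_eq]
  omega

/-- The compressed size is at most the size, hence at most `B.eval n`. A numeral `m` adds `2 * m +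
3` vertices, giving `3 + 3 * B` in total; `χ.comp B` pays the charge, as polynomials over `ℕ` are
monotone. -/
theorem Sound.cs {χ : Polynomial ℕ} {Γ : List GTy} {P : PF} {e : Expr}
    (h : Sound (fun s => χ.eval s) Γ e (GTy.mu P)) :
    Sound (fun s => χ.eval s) Γ (.cs P e) (GTy.mu natPF) := by
  obtain ⟨B, h⟩ := h
  refine ⟨Polynomial.C 3 + Polynomial.C 3 * B + χ.comp B, fun n H θ hθ => ?_⟩
  obtain ⟨H', a, c, hev, o⟩ := h n H θ hθ
  have hc := o.cost; have hl := o.len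
  have hm : compSize H' (GTy.mu P) a ≤ size H' a := o.good.1.compSize_le
  have hs := o.good.2
  have hχ := eval_le_eval χ hs
  have hp := prefix_numeral H' (compSize H' (GTy.mu P) a)
  have hlen := length_numeral H' (compSize H' (GTy.mu P) a)
  have ⟨ht, hw⟩ := numeral_spec H' (compSize H' (GTy.mu P) a)
  have hsz := size_le_of_within hw
  simp only [Polynomial.eval_add, Polynomial.eval_mul, Polynomial.eval_C, Polynomial.eval_comp]
  refine ⟨_, _, _, .cs hev, o.pre.trans hp, by omega, by omega, ⟨ht, by omega⟩,
    fun S hS _ b hb => hS b (o.pre.length_le.trans (hw b hb))⟩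

theorem Sound.fold {χ : ℕ → ℕ} {Γ : List GTy} {P : PF} {e₀ e₁ : Expr} {γ : GTy}
    (h₀ : Sound χ (P.app γ.toSafe :: Γ) e₀ γ.toSafe) (h₁ : Sound χ Γ e₁ (GTy.mu P)) :
    Sound χ Γ (.fold P (.lam e₀) e₁) γ.toSafe := by
  obtain ⟨B₀, h₀⟩ := h₀
  obtain ⟨B, h₁⟩ := h₁
  -- The 2 pays for the fold node and the allowance 1 at the root. The product is the price of a
  -- table entry times a bound on the number of entries; the step function runs with normal parts
  -- bounded by `n + B.eval n`.
  refine ⟨Polynomial.C 2 + B + (Polynomial.C (P.weight + 1) + B₀.comp (.X + B)) * B,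
    fun n H θ hθ => ?_⟩
  obtain ⟨H₁, r, c₁, hev₁, o₁⟩ := h₁ n H θ hθ
  -- One evaluation must serve every `S` in the `within` clause, so all admissible sets are carried
  -- through the fold at once.
  let 𝒮 : Set (Set ℕ) := {S | (∀ b, H.length ≤ b → b ∈ S) ∧
    EnvWithin H S Γ (Expr.fold P (.lam e₀) e₁).FreeIn θ}
  obtain ⟨H', M', v, c, hf, s⟩ := (fold_exists (χ := χ) (P := P) (e₀ := e₀) (Γ := Γ) (θ := θ)
    (γ := γ) (n := n + B.eval n) (β := B₀.eval (n + B.eval n)) (r := r) (H := H₁) (𝒮 := 𝒮)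
    (fun Hc θ' hθ' => h₀ _ Hc θ' hθ')
    (hθ.mono o₁.pre (by omega)) (o₁.good.2.trans (by omega))
    (fun S hS b hb => hS.1 b (o₁.pre.length_le.trans hb))
    (fun S hS => (hS.2.imp fun i hi => .inl hi).mono o₁.pre hθ)
    (fun S hS => o₁.within S hS.1 (hS.2.imp fun i hi => .inr hi)) o₁.good.1 .refl).1 rfl H₁
    (fun _ => none) ⟨List.prefix_rfl, by simp, by simp⟩
  have hK := Nat.mul_le_mul_left (P.weight + 1 + B₀.eval (n + B.eval n))
    ((entries_le H₁ r M').trans o₁.good.2)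
  have hc := s.cost; have hl := s.len; have hc₁ := o₁.cost; have hl₁ := o₁.len
  simp only [Polynomial.eval_add, Polynomial.eval_mul, Polynomial.eval_C, Polynomial.eval_comp,
    Polynomial.eval_X]
  refine ⟨H', v, _, .fold hev₁ hf, o₁.pre.trans s.pre, by omega, by omega,
    γ.toSafe_toSafe ▸ s.good.toSafe _, fun S hS hSθ => s.within S ⟨hS, hSθ⟩⟩

/-- Variables have ground types, so a term of arrow type is literally a `lam`; its bound is stated
for the body, which is where `app` and `fold` run it. -/
theorem sound (χ : Polynomial ℕ) {Γ : List GTy} {e : Expr} {τ : Ty} (h : HasTy Γ e τ) :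
    match τ with
    | .ground γ => Sound (fun s => χ.eval s) Γ e γ
    | .arrow γ₁ γ₀ => ∃ e₀, e = .lam e₀ ∧ Sound (fun s => χ.eval s) (γ₁ :: Γ) e₀ γ₀ := by
  induction h with
  | @var Γ i γ hi =>
    refine ⟨.X + 1, fun n H θ hθ => ?_⟩
    obtain ⟨a, ha, hg⟩ := hθ i γ hi
    simp only [Polynomial.eval_add, Polynomial.eval_one, Polynomial.eval_X]
    exact ⟨H, a, 1, .var ha, List.prefix_rfl, by omega, by omega,
      hg.mono List.prefix_rfl (by omega), fun S _ hS => hS i γ a hi rfl ha⟩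
  | lam _ ih => exact ⟨_, rfl, ih⟩
  | app _ _ ih₀ ih₁ =>
    obtain ⟨e, rfl, B₀, h₀⟩ := ih₀
    obtain ⟨B₁, h₁⟩ := ih₁
    refine ⟨1 + B₁ + B₀.comp (.X + B₁), fun n H θ hθ => ?_⟩
    obtain ⟨H₁, a₁, c₁, hev, o⟩ := h₁ n H θ hθ
    exact Sound.bind h₀ o hθ (fun i hi => .inl hi) (fun i hi => .inr hi) o.good .refl
      fun _ _ _ h => .app hev h
  | unit =>
    refine ⟨1, fun n H θ hθ => ?_⟩
    simp only [Polynomial.eval_one]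
    have hg := getElem?_snoc H .unit
    exact ⟨_, _, _, .unit, List.prefix_append _ _, le_rfl, by simp,
      ⟨.unit hg, by rw [size_unit hg]; omega⟩, fun S hS _ =>
        within_of_children hg (hS _ le_rfl) (by simp [Node.children])⟩
  | safeUnit =>
    refine ⟨1, fun n H θ hθ => ?_⟩
    simp only [Polynomial.eval_one]
    have hg := getElem?_snoc H .unit
    exact ⟨_, _, _, .safeUnit, List.prefix_append _ _, le_rfl, by simp, .unit hg, fun S hS _ =>
        within_of_children hg (hS _ le_rfl) (by simp [Node.children])⟩
  | pair _ _ ih₁ ih₂ =>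
    obtain ⟨B₁, h₁⟩ := ih₁
    obtain ⟨B₂, h₂⟩ := ih₂
    refine ⟨1 + B₁ + B₂, fun n H θ hθ => ?_⟩
    obtain ⟨H₁, a₁, c₁, hev₁, o₁⟩ := h₁ n H θ hθ
    obtain ⟨H₂, a₂, c₂, hev₂, o₂⟩ := h₂ n H₁ θ (hθ.mono o₁.pre le_rfl)
    have hp : H₂ <+: H₂ ++ [Node.pair a₁ a₂] := List.prefix_append _ _
    have hg := getElem?_snoc H₂ (Node.pair a₁ a₂)
    have := o₁.cost; have := o₁.len; have := o₂.cost; have := o₂.len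
    simp only [Polynomial.eval_add, Polynomial.eval_one]
    refine ⟨_, _, _, .pair hev₁ hev₂, o₁.pre.trans (o₂.pre.trans hp), by omega, ?_,
      ⟨a₁, a₂, hg, o₁.good.mono (o₂.pre.trans hp) (by omega), o₂.good.mono hp (by omega)⟩,
      fun S hS hSθ => ?_⟩
    · simp only [List.length_append, List.length_singleton]; omega
    · refine within_of_children hg
        (hS _ (o₁.pre.length_le.trans o₂.pre.length_le)) fun x hx => ?_
      simp only [Node.children, List.mem_cons, List.not_mem_nil, or_false] at hx
      rcases hx with rfl | rfl
      · exact (o₁.within S hS (hSθ.imp fun i hi => .inl hi)).mono (o₂.pre.trans hp) o₁.good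
      · exact (o₂.within S (fun x hx => hS x (o₁.pre.length_le.trans hx))
          ((hSθ.imp fun i hi => .inr hi).mono o₁.pre hθ)).mono hp o₂.good
  | fst _ ih =>
    exact ih.of_reach (fun _ h => h) fun n H a ⟨b₁, b₂, hb, h₁, h₂⟩ =>
      ⟨b₁, .child hb (by simp [Node.children]), h₁, fun _ _ _ h => .fst h hb⟩
  | snd _ ih =>
    exact ih.of_reach (fun _ h => h) fun n H a ⟨b₁, b₂, hb, h₁, h₂⟩ =>
      ⟨b₂, .child hb (by simp [Node.children]), h₂, fun _ _ _ h => .snd h hb⟩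
  | inl _ ih =>
    exact ih.of_vertex (N := .inl) (K := 1) (fun _ h => h) (fun _ => rfl)
      (fun n H a b h hb => .inl ⟨a, hb, h.mono List.prefix_rfl (by omega)⟩)
      fun _ _ _ _ _ h => .inl h
  | inr _ ih =>
    exact ih.of_vertex (N := .inr) (K := 1) (fun _ h => h) (fun _ => rfl)
      (fun n H a b h hb => .inr ⟨a, hb, h.mono List.prefix_rfl (by omega)⟩)
      fun _ _ _ _ _ h => .inr h
  | @case Γ e₀ e₁ e₂ γ₁ γ₂ γ _ _ _ _ ih₀ ih₁ ih₂ =>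
    obtain ⟨B₀, h₀⟩ := ih₀
    obtain ⟨B₁, h₁⟩ := ih₁
    obtain ⟨B₂, h₂⟩ := ih₂
    refine ⟨(1 + B₀ + B₁.comp (.X + B₀)) + (1 + B₀ + B₂.comp (.X + B₀)), fun n H θ hθ => ?_⟩
    obtain ⟨H₁, a, c, hev, o⟩ := h₀ n H θ hθ
    rcases o.good with ⟨b, hb, hg⟩ | ⟨b, hb, hg⟩
    · obtain ⟨H', v, c', hev', o'⟩ := Sound.bind (e := .case e₀ e₁ e₂) h₁ o hθ
        (fun i hi => .inr (.inl hi)) (fun i hi => .inl hi) hg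
        (.child hb (by simp [Node.children])) fun _ _ _ h => .caseInl hev hb h
      exact ⟨H', v, c', hev', o'.mono (by simp only [Polynomial.eval_add]; omega)⟩
    · obtain ⟨H', v, c', hev', o'⟩ := Sound.bind (e := .case e₀ e₁ e₂) h₂ o hθ
        (fun i hi => .inr (.inr hi)) (fun i hi => .inl hi) hg
        (.child hb (by simp [Node.children])) fun _ _ _ h => .caseInr hev hb h
      exact ⟨H', v, c', hev', o'.mono (by simp only [Polynomial.eval_add]; omega)⟩
  | @con Γ P e _ ih =>
    -- The parts of the argument are merged into one normal graph, so their bounds add up, with one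
    -- more for the new constructor.
    refine ih.of_vertex (N := .con P) (K := (P.app (GTy.mu P)).leaves) (fun _ h => h)
      (fun _ => rfl) (fun n H a b h hb => ⟨.con hb ?_, ?_⟩) fun _ _ _ _ _ h => .con h
    · simpa only [IsValue, (P.isNormal_app_mu P).toNorm_eq] using h.isValue
    · exact (size_con_le hb).trans (Nat.succ_le_succ (h.size_le (P.isNormal_app_mu P)))
  | @des Γ P e _ ih =>
    refine ih.of_reach (fun _ h => h) fun n H a ⟨ht, hs⟩ => ?_
    cases ht with
    | con hb ht =>
      exact ⟨_, .child hb (by simp [Node.children]), .of_valTy (P.isNormal_app_mu P) ht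
        ((size_le_of_reach (.child hb (by simp [Node.children]))).trans hs),
        fun _ _ _ h => .des h hb⟩
  | fold _ _ ih₀ ih₁ =>
    obtain ⟨e, he, ih₀⟩ := ih₀
    cases he
    exact ih₀.fold ih₁
  | @safeCon Γ P e _ ih =>
    refine ih.of_vertex (N := .con P) (K := 0) (fun _ h => h)
      (fun _ => rfl) (fun n H a b h hb => .con hb ?_) fun _ _ _ _ _ h => .safeCon h
    simpa only [IsValue, GTy.toNorm_toSafe, (P.isNormal_app_mu P).toNorm_eq] using h.isValue
  | @safeDes Γ P e _ ih =>
    refine ih.of_reach (fun _ h => h) fun n H a ht => ?_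
    cases ht with
    | @con _ _ b hb ht =>
      -- The actual size serves as a provisional bound, which `toSafe` then discards.
      exact ⟨b, .child hb (by simp [Node.children]),
        (Good.of_valTy (P.isNormal_app_mu P) ht le_rfl).toSafe n, fun _ _ _ h => .safeDes h hb⟩
  | toSafe _ ih =>
    exact ih.of_reach (fun _ h => h) fun n H a h =>
      ⟨a, .refl, h.toSafe n, fun _ _ _ h => .toSafe h⟩
  | toNorm _ hΓ ih => exact ih.toNorm hΓ
  | cs _ ih => exact ih.cs

/-! ### Determinism -/

/-- The term, the label of the inspected vertex and the table entry select a single rule. The three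
judgments are mutually inductive, hence the explicit motives. -/
theorem Eval.det {χ : ℕ → ℕ} {θ : List ℕ} {H H₁ : Heap} {e : Expr} {a₁ c₁ : ℕ}
    (h : Eval χ θ H e H₁ a₁ c₁) : ∀ {H₂ a₂ c₂}, Eval χ θ H e H₂ a₂ c₂ →
      H₁ = H₂ ∧ a₁ = a₂ ∧ c₁ = c₂ := by
  induction h using Eval.rec
    (motive_2 := fun P e₀ θ H M a H₁ M₁ v₁ c₁ _ => ∀ {H₂ M₂ v₂ c₂},
      FoldAt χ P e₀ θ H M a H₂ M₂ v₂ c₂ → H₁ = H₂ ∧ M₁ = M₂ ∧ v₁ = v₂ ∧ c₁ = c₂)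
    (motive_3 := fun P e₀ θ Q H M b H₁ M₁ v₁ c₁ _ => ∀ {H₂ M₂ v₂ c₂},
      MapAt χ P e₀ θ Q H M b H₂ M₂ v₂ c₂ → H₁ = H₂ ∧ M₁ = M₂ ∧ v₁ = v₂ ∧ c₁ = c₂)
  case var h | unit | safeUnit => intro _ _ _ h'; cases h'; simp_all
  case app _ _ ih₁ ih₂ =>
    intro _ _ _ h'
    cases h' with
    | app h₁ h₂ =>
      obtain ⟨rfl, rfl, rfl⟩ := ih₁ h₁
      obtain ⟨rfl, rfl, rfl⟩ := ih₂ h₂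
      simp
  case pair _ _ ih₁ ih₂ =>
    intro _ _ _ h'
    cases h' with
    | pair h₁ h₂ =>
      obtain ⟨rfl, rfl, rfl⟩ := ih₁ h₁
      obtain ⟨rfl, rfl, rfl⟩ := ih₂ h₂
      simp
  case fst _ hb ih | snd _ hb ih | des _ hb ih | safeDes _ hb ih =>
    intro _ _ _ h'
    cases h'
    rename_i h₁ hb'
    obtain ⟨rfl, rfl, rfl⟩ := ih h₁
    rw [hb] at hb'
    cases hb'
    simp
  case inl _ ih | inr _ ih | con _ ih | safeCon _ ih | toSafe _ ih | toNorm _ ih | cs _ ih =>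
    intro _ _ _ h'
    cases h'
    rename_i h₁
    obtain ⟨rfl, rfl, rfl⟩ := ih h₁
    simp
  case caseInl _ hb _ ih₁ ih₂ =>
    intro _ _ _ h'
    cases h' with
    | caseInl h₁ hb' h₂ =>
      obtain ⟨rfl, rfl, rfl⟩ := ih₁ h₁
      rw [hb] at hb'
      cases hb'
      obtain ⟨rfl, rfl, rfl⟩ := ih₂ h₂
      simp
    | caseInr h₁ hb' h₂ =>
      obtain ⟨rfl, rfl, rfl⟩ := ih₁ h₁
      rw [hb] at hb'
      cases hb'
  case caseInr _ hb _ ih₁ ih₂ =>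
    intro _ _ _ h'
    cases h' with
    | caseInr h₁ hb' h₂ =>
      obtain ⟨rfl, rfl, rfl⟩ := ih₁ h₁
      rw [hb] at hb'
      cases hb'
      obtain ⟨rfl, rfl, rfl⟩ := ih₂ h₂
      simp
    | caseInl h₁ hb' h₂ =>
      obtain ⟨rfl, rfl, rfl⟩ := ih₁ h₁
      rw [hb] at hb'
      cases hb'
  case fold _ _ ih₁ ih₂ =>
    intro _ _ _ h'
    cases h' with
    | fold h₁ h₂ =>
      obtain ⟨rfl, rfl, rfl⟩ := ih₁ h₁
      obtain ⟨rfl, rfl, rfl, rfl⟩ := ih₂ h₂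
      simp
  case hit h _ _ _ _ h' =>
    cases h' <;> simp_all
  case miss hM hb _ _ ih₁ ih₂ _ _ _ _ h' =>
    cases h' with
    | hit h => simp_all
    | miss _ hb' h₁ h₂ =>
      rw [hb] at hb'
      cases hb'
      obtain ⟨rfl, rfl, rfl, rfl⟩ := ih₁ h₁
      obtain ⟨rfl, rfl, rfl⟩ := ih₂ h₂
      simp
  case id _ ih _ _ _ _ h' =>
    cases h' with
    | id h =>
      obtain ⟨rfl, rfl, rfl, rfl⟩ := ih h
      simp
  case cunit _ _ _ _ h' | cmu _ _ _ _ h' => cases h'; simp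
  case prod hb _ _ ih₁ ih₂ _ _ _ _ h' =>
    cases h' with
    | prod hb' h₁ h₂ =>
      rw [hb] at hb'
      cases hb'
      obtain ⟨rfl, rfl, rfl, rfl⟩ := ih₁ h₁
      obtain ⟨rfl, rfl, rfl, rfl⟩ := ih₂ h₂
      simp
  all_goals
    intros
    rename_i hb _ ih _ _ _ _ h'
    cases h' <;> rename_i hb' h₁ <;> rw [hb] at hb' <;> cases hb'
    obtain ⟨rfl, rfl, rfl, rfl⟩ := ih h₁
    simp

end RS11

/-- Polynomial-time soundness.  The charge `χ = 0` for the compressed-size rule gives exactly the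
number of nodes of the derivation tree. -/
theorem theoremt (f : RS11.Expr) (γ₁ γ₀ : RS11.GTy)
    (hf : RS11.HasTy [] f (.arrow γ₁ γ₀)) (hγ₁ : γ₁.IsNormal) (χ : Polynomial ℕ) :
    RS11.DPPolyCost (fun s => χ.eval s) f γ₁ := by
  obtain ⟨e, rfl, B, h⟩ := RS11.sound χ hf
  -- The 2 counts the application node and the look-up of its argument.
  refine ⟨2 + B, fun H r hr => ?_⟩
  have hg : RS11.Good H (RS11.size H r) γ₁ r :=
    .of_valTy hγ₁ (by simpa only [RS11.IsValue, hγ₁.toNorm_eq] using hr) le_rfl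
  -- The body runs with `r` pushed onto the ambient environment `[r]`; only index 0 is typed, as `f`
  -- is closed.
  obtain ⟨H', a, c, hev, o⟩ := h _ H [r, r] (.cons hg fun i γ hi => by simp at hi)
  have happ : RS11.Eval (fun s => χ.eval s) [r] H (.app (.lam e) (.var 0)) H' a (1 + 1 + c) :=
    .app (.var rfl) hev
  refine ⟨⟨H', a, _, happ⟩, fun H'' a' c' h' => ?_⟩
  obtain ⟨-, -, rfl⟩ := happ.det h'
  rw [Polynomial.eval_add, Polynomial.eval_ofNat]
  exact Nat.add_le_add_left o.cost 2
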